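/- Let $d\ge 1$ and $p$ be integers, let $\Theta\subset\mathbb R^p$ be compact and convex, and let $\theta_0\in\Theta$. Sampling scheme. Let $\tau\in[0,1/2)$, $\mathcal Q=[-1,1]^d$, and let $(v_i)_{i\ge1}$ be a sequence of points with positive integer coordinates such that $\{v_i: 1\le i\le I^d\}=\{1,\dots,I\}^d$ for every integer $I\ge 1$. On a probability space $(\Omega,\mathcal F,\mathbb P)$ let $X_1,X_2,\dots$ be independent random vectors with values in $\mathcal Q$ and a common law that has a density (with respect to Lebesgue measure on $\mathcal Q$) which is strictly positive on $\mathcal Q$. Put $S_i=v_i+\tau X_i$. Let $Z=(Z_s)_{s\in\mathbb R^d}$ be a real-valued zero-mean stationary Gaussian random field on $(\Omega,\mathcal F,\mathbb P)$ with $\operatorname{Cov}(Z_s,Z_t)=c_{\theta_0}(s-t)$, which is jointly measurable and independent of $X=(X_i)$, in the sense that there is a $\sigma$-algebra $\mathcal G\subset\mathcal F$ independent of $X$ such that $(s,\omega)\mapsto Z_s(\omega)$ is $\mathfrak B(\mathbb R^d)\otimes\mathcal G$-measurable. Write $Z_{(n)}=(Z_{S_1},\dots,Z_{S_n})$. Assumption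 1 (first order version). The functions $c_\theta:\mathbb R^d\to\mathbb R$, $\theta\in\Theta$, satisfy: (1) there are constants $C,L$ such that for all $\theta\in\Theta$ the support of $c_\theta$ is contained in the closed ball $\mathrm B[0;C]$ and $|c_\theta|\le L$; (2) for each $s\in\mathbb R^d$ the function $\theta\mapsto c_\theta(s)$ is continuously differentiable on $\Theta$ (at boundary points, derivatives are taken within $\Theta$), and there are constants $C',L'$ such that for all $\theta\in\Theta$ and all $i$ the function $s\mapsto\frac{\partial c_\theta}{\partial\theta_i}(s)$ has support in $\mathrm B[0;C']$ and is bounded by $L'$ in absolute value; (3) $c_\theta(s)=\int_{\mathbb R^d}\hat c_\theta(f)e^{\mathrm i\langle f,s\rangle}\,df$ for all $\theta\in\Theta$, $s\in\mathbb R^d$, where $\hat c_\theta$ is integrable and $(\theta,f)\mapsto\hat c_\theta(f)$ is continuous and strictly positive on $\Theta\times\mathbb R^d$. Assumption 2 (first order version). The functions $\tilde c_{m,\theta}:\mathbb R^d\to\mathbb R$, $m\in\mathbb N$, $\theta\in\Theta$, satisfy: each $\tilde c_{m,\theta}$ is Borel measurable and even; (1) and (2) of Assumption 1 hold for $\{\tilde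 c_{m,\theta}:\theta\in\Theta\}$, for each $m$, with constants that do not depend on $m$; and, as $m\to\infty$, $\sup_{\theta\in\Theta}\sup_{s}|\tilde c_{m,\theta}(s)-c_\theta(s)|\to0$ and $\sup_{\theta\in\Theta}\sup_s\big|\frac{\partial\tilde c_{m,\theta}}{\partial\theta_i}(s)-\frac{\partial c_\theta}{\partial\theta_i}(s)\big|\to0$ for $i=1,\dots,p$. Assumption 3 (global identifiability). If $\tau=0$, there is no $\theta\in\Theta\setminus\{\theta_0\}$ with $c_\theta(z)=c_{\theta_0}(z)$ for all $z\in\mathbb Z^d$. If $\tau\ne0$, there is no $\theta\in\Theta\setminus\{\theta_0\}$ such that $c_\theta-c_{\theta_0}=0$ Lebesgue-almost everywhere on $D_\tau=\bigcup_{z\in\mathbb Z^d\setminus\{0\}}\big(z+\tau\{u_1-u_2:u_1,u_2\in\mathcal Q\}\big)$ and $c_\theta(0)=c_{\theta_0}(0)$. Estimators. Let $r:\mathbb N\to\mathbb N$ satisfy $r(n)\to\infty$, and let $\widetilde\Sigma_{n,\theta}=[\tilde c_{r(n),\theta}(S_i-S_j)]_{1\le i,j\le n}$. For a real symmetric matrix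 $A$ let $\det_+(A)$ be the product of its strictly positive eigenvalues (with multiplicity; $1$ if there are none), and let $A^+$ be its Moore–Penrose inverse. Put $$\tilde l_n(\theta)=\frac1n\log\det\nolimits_+\big(\widetilde\Sigma_{n,\theta}\big)+\frac1n\big\langle Z_{(n)},\widetilde\Sigma_{n,\theta}^{+}Z_{(n)}\big\rangle .$$ A sequence of truncated-ML estimators is a sequence $(\hat\theta_n)_{n\ge1}$ on $\Omega$ such that, for every $n\ge1$, almost surely $\hat\theta_n\in\Theta$ and $\hat\theta_n$ minimizes $\tilde l_n$ over $\Theta$. Theorem. Under Assumptions 1, 2 and 3, every sequence $(\hat\theta_n)$ of truncated-ML estimators converges in probability to $\theta_0$. -/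

import Mathlib

open MeasureTheory ProbabilityTheory Filter Topology

/-- `ℝ^k` with the Euclidean norm and inner product. -/
abbrev Eucl (k : ℕ) : Type := EuclideanSpace ℝ (Fin k)

/-! ### The sampling scheme -/

/-- The cube `[-1, 1]^d`. -/
def cube (d : ℕ) : Set (Eucl d) := {x | ∀ k, x k ∈ Set.Icc (-1 : ℝ) 1}

/-- An integer vector regarded as a point of `ℝ^d`. -/
noncomputable def intPoint {d : ℕ} (z : Fin d → ℤ) : Eucl d :=
  WithLp.toLp 2 (fun k => (z k : ℝ))

/-- The sequence `v` of points with positive integer coordinates runs through the grids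
`{1, …, I}^d` in turn: its first `I ^ d` terms are exactly the points of `{1, …, I}^d`, for every
`I ≥ 1`. The sequence is indexed from `0`. -/
def IsGridEnumeration {d : ℕ} (v : ℕ → Fin d → ℕ) : Prop :=
  ∀ I : ℕ, 1 ≤ I → v '' Set.Iio (I ^ d) = {w | ∀ k, 1 ≤ w k ∧ w k ≤ I}

/-- The observation point `S_i = v_i + τ X_i` of the randomly perturbed grid. -/
noncomputable def site {Ω : Type*} {d : ℕ} (τ : ℝ) (v : ℕ → Fin d → ℕ) (X : ℕ → Ω → Eucl d)
    (i : ℕ) (ω : Ω) : Eucl d :=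
  intPoint (fun k => (v i k : ℤ)) + τ • X i ω

/-- The perturbations `X_i` are independent random vectors with values in `[-1, 1]^d`, and they
have a common law which has a density with respect to Lebesgue measure on the cube that is strictly
positive there. -/
structure IsPerturbation {Ω : Type*} [MeasurableSpace Ω] (P : Measure Ω) {d : ℕ}
    (X : ℕ → Ω → Eucl d) : Prop where
  measurable : ∀ i, Measurable (X i)
  mem_cube : ∀ i ω, X i ω ∈ cube d
  indep : iIndepFun X P
  density : ∃ f : Eucl d → ENNReal, Measurable f ∧ (∀ x ∈ cube d, 0 < f x) ∧
    ∀ i, P.map (X i) = (volume.restrict (cube d)).withDensity f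

/-- `Z` is a zero-mean stationary Gaussian random field on `ℝ^d` with covariance function `c₀`,
independent of the sequence `X`. The field is jointly measurable, where the measurability in `ω` is
with respect to a σ-algebra that is independent of `X`. (If the paths of `Z` are continuous, then
one can take the σ-algebra generated by the variables `Z s`.) -/
structure IsFieldIndepOf {Ω : Type*} [mΩ : MeasurableSpace Ω] (P : Measure Ω) {d : ℕ}
    (Z : Eucl d → Ω → ℝ) (c₀ : Eucl d → ℝ) (X : ℕ → Ω → Eucl d) : Prop where
  gaussian : IsGaussianProcess Z P
  mean_zero : ∀ s, ∫ ω, Z s ω ∂P = 0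
  covariance_eq : ∀ s t, cov[Z s, Z t; P] = c₀ (s - t)
  measurable_indep : ∃ 𝓖 : MeasurableSpace Ω, 𝓖 ≤ mΩ ∧
    Measurable[MeasurableSpace.prod (inferInstance : MeasurableSpace (Eucl d)) 𝓖]
      (fun q : Eucl d × Ω => Z q.1 q.2) ∧
    Indep 𝓖 (MeasurableSpace.comap (fun ω i => X i ω) inferInstance) P

/-! ### Regularity of families of functions indexed by the parameter -/

/-- The functions `g a`, for `a ∈ A`, are bounded by one constant and have compact supports
contained in one ball. -/
def UniformlyBoundedCompactSupport {ι : Type*} {d : ℕ} (A : Set ι) (g : ι → Eucl d → ℝ) : Prop :=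
  ∃ C L : ℝ, ∀ a ∈ A, tsupport (g a) ⊆ Metric.closedBall 0 C ∧ ∀ s, |g a s| ≤ L

/-- For every `s`, the map `θ ↦ c θ s` is continuously differentiable on `Θ`, and
`dc θ s` is the vector of its first order partial derivatives. Only values at points of `Θ` enter;
at a boundary point of `Θ` the derivative is taken within `Θ`. -/
def HasContinuousPartials {d p : ℕ} (Θ : Set (Eucl p)) (c : Eucl p → Eucl d → ℝ)
    (dc : Eucl p → Eucl d → Eucl p) : Prop :=
  ∀ s, (∀ θ ∈ Θ, HasGradientWithinAt (fun η => c η s) (dc θ s) Θ θ) ∧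
    ContinuousOn (fun θ => dc θ s) Θ

/-- Fourier inversion: each `c θ`, `θ ∈ Θ`, is the Fourier integral of a spectral density which is
jointly continuous in the parameter and the frequency, and strictly positive. -/
def HasPositiveSpectralDensity {d p : ℕ} (Θ : Set (Eucl p)) (c : Eucl p → Eucl d → ℝ) : Prop :=
  ∃ chat : Eucl p → Eucl d → ℝ,
    ContinuousOn (fun q : Eucl p × Eucl d => chat q.1 q.2) (Θ ×ˢ Set.univ) ∧
    (∀ θ ∈ Θ, ∀ f, 0 < chat θ f) ∧
    ∀ θ ∈ Θ, Integrable (chat θ) ∧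
      ∀ s, (c θ s : ℂ) = ∫ f, (chat θ f : ℂ) * Complex.exp (Complex.I * (inner ℝ f s : ℝ))

/-- Regularity conditions on the family of covariance functions (of first order in `θ`);
`dc θ s` is the gradient of `θ ↦ c θ s`. -/
structure CovarianceRegularity {d p : ℕ} (Θ : Set (Eucl p)) (c : Eucl p → Eucl d → ℝ)
    (dc : Eucl p → Eucl d → Eucl p) : Prop where
  bounded : UniformlyBoundedCompactSupport Θ c
  partials : HasContinuousPartials Θ c dc
  partials_bounded :
    UniformlyBoundedCompactSupport (Θ ×ˢ (Set.univ : Set (Fin p))) (fun a s => dc a.1 s a.2)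
  spectral : HasPositiveSpectralDensity Θ c

/-- Regularity conditions on the approximations `ctil m θ` of `c θ` (of first order in `θ`);
`dctil m θ s` is the gradient of `θ ↦ ctil m θ s`. All constants are uniform in `m`. -/
structure ApproximationRegularity {d p : ℕ} (Θ : Set (Eucl p)) (c : Eucl p → Eucl d → ℝ)
    (dc : Eucl p → Eucl d → Eucl p) (ctil : ℕ → Eucl p → Eucl d → ℝ)
    (dctil : ℕ → Eucl p → Eucl d → Eucl p) : Prop where
  measurable : ∀ m, ∀ θ ∈ Θ, Measurable (ctil m θ)
  even : ∀ m, ∀ θ ∈ Θ, ∀ s, ctil m θ (-s) = ctil m θ s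
  bounded : UniformlyBoundedCompactSupport ((Set.univ : Set ℕ) ×ˢ Θ) (fun a => ctil a.1 a.2)
  tendsto : TendstoUniformlyOn (fun m (q : Eucl p × Eucl d) => ctil m q.1 q.2)
    (fun q => c q.1 q.2) atTop (Θ ×ˢ Set.univ)
  partials : ∀ m, HasContinuousPartials Θ (ctil m) (dctil m)
  partials_bounded :
    UniformlyBoundedCompactSupport ((Set.univ : Set ℕ) ×ˢ Θ ×ˢ (Set.univ : Set (Fin p)))
      (fun a s => dctil a.1 a.2.1 s a.2.2)
  partials_tendsto : ∀ i : Fin p,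
    TendstoUniformlyOn (fun m (q : Eucl p × Eucl d) => dctil m q.1 q.2 i)
      (fun q => dc q.1 q.2 i) atTop (Θ ×ˢ Set.univ)

/-! ### Identifiability -/

/-- The set `D_τ`, the union over nonzero `z ∈ ℤ^d` of the sets `z + τ U`, where `U` is the set
of differences of two points of the cube. -/
def differenceSet (d : ℕ) (τ : ℝ) : Set (Eucl d) :=
  {s | ∃ z : Fin d → ℤ, z ≠ 0 ∧ ∃ u₁ ∈ cube d, ∃ u₂ ∈ cube d, s = intPoint z + τ • (u₁ - u₂)}

/-- Asymptotic (global) identifiability of `θ₀`. -/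
def AsymptoticallyIdentifiable {d p : ℕ} (τ : ℝ) (Θ : Set (Eucl p)) (c : Eucl p → Eucl d → ℝ)
    (θ₀ : Eucl p) : Prop :=
  (τ = 0 → ¬ ∃ θ ∈ Θ, θ ≠ θ₀ ∧ ∀ z : Fin d → ℤ, c θ (intPoint z) = c θ₀ (intPoint z)) ∧
  (τ ≠ 0 → ¬ ∃ θ ∈ Θ, θ ≠ θ₀ ∧
    (∀ᵐ s ∂(volume.restrict (differenceSet d τ)), c θ s - c θ₀ s = 0) ∧ c θ 0 = c θ₀ 0)

/-! ### Pseudo-determinant and pseudoinverse -/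

/-- The product of the strictly positive eigenvalues, with multiplicity, of a real square matrix
(`1` if there are none). -/
noncomputable def pseudoDet {n : ℕ} (A : Matrix (Fin n) (Fin n) ℝ) : ℝ :=
  (A.charpoly.roots.filter (fun x => 0 < x)).prod

/-- `B` is a Moore-Penrose inverse of the real square matrix `A`. -/
structure IsMoorePenrose {n : ℕ} (A B : Matrix (Fin n) (Fin n) ℝ) : Prop where
  mul_mul_left : A * B * A = A
  mul_mul_right : B * A * B = B
  symm_left : (A * B).transpose = A * B
  symm_right : (B * A).transpose = B * A

open Classical in
/-- The Moore-Penrose inverse of a real square matrix. -/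
noncomputable def pseudoInverse {n : ℕ} (A : Matrix (Fin n) (Fin n) ℝ) :
    Matrix (Fin n) (Fin n) ℝ :=
  if h : ∃ B, IsMoorePenrose A B then h.choose else 0

theorem IsMoorePenrose.unique {n : ℕ} {A B C : Matrix (Fin n) (Fin n) ℝ}
    (hB : IsMoorePenrose A B) (hC : IsMoorePenrose A C) : B = C := by
  have h1 : A * B = A * C := by
    calc A * B = (A * C * A) * B := by rw [hC.mul_mul_left]
      _ = (A * C).transpose * (A * B).transpose := by
          rw [hC.symm_left, hB.symm_left]; simp only [Matrix.mul_assoc]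
      _ = ((A * B * A) * C).transpose := by
          rw [← Matrix.transpose_mul]; simp only [Matrix.mul_assoc]
      _ = A * C := by rw [hB.mul_mul_left, hC.symm_left]
  have h2 : B * A = C * A := by
    calc B * A = B * (A * C * A) := by rw [hC.mul_mul_left]
      _ = (B * A).transpose * (C * A).transpose := by
          rw [hC.symm_right, hB.symm_right]; simp only [Matrix.mul_assoc]
      _ = (C * (A * B * A)).transpose := by
          rw [← Matrix.transpose_mul]; simp only [Matrix.mul_assoc]
      _ = C * A := by rw [hB.mul_mul_left, hC.symm_right]
  calc B = B * A * B := hB.mul_mul_right.symm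
    _ = C * A * B := by rw [h2]
    _ = C * (A * B) := Matrix.mul_assoc _ _ _
    _ = C * A * C := by rw [h1, Matrix.mul_assoc]
    _ = C := hC.mul_mul_right

/-- Every real symmetric matrix has a Moore-Penrose inverse. -/
theorem exists_isMoorePenrose {n : ℕ} (A : Matrix (Fin n) (Fin n) ℝ) (hA : A.IsHermitian) :
    ∃ B, IsMoorePenrose A B := by
  obtain ⟨U, D, hU, h⟩ : ∃ (U : Matrix (Fin n) (Fin n) ℝ) (D : Fin n → ℝ),
      U.transpose * U = 1 ∧ A = U * Matrix.diagonal D * U.transpose := by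
    refine ⟨hA.eigenvectorUnitary, hA.eigenvalues, ?_, ?_⟩
    · have := Unitary.coe_star_mul_self hA.eigenvectorUnitary
      rwa [Matrix.star_eq_conjTranspose, Matrix.conjTranspose_eq_transpose_of_trivial] at this
    · have := hA.spectral_theorem
      rwa [Unitary.conjStarAlgAut_apply, Matrix.star_eq_conjTranspose,
        Matrix.conjTranspose_eq_transpose_of_trivial] at this
  have key : ∀ E F : Fin n → ℝ, (U * Matrix.diagonal E * U.transpose) *
      (U * Matrix.diagonal F * U.transpose) =
        U * Matrix.diagonal (fun i => E i * F i) * U.transpose := by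
    intro E F
    calc _ = U * Matrix.diagonal E * (U.transpose * U) * Matrix.diagonal F * U.transpose := by
            simp only [Matrix.mul_assoc]
      _ = _ := by
            rw [hU, Matrix.mul_one, Matrix.mul_assoc U, Matrix.diagonal_mul_diagonal]
  have symm : ∀ E : Fin n → ℝ, (U * Matrix.diagonal E * U.transpose).transpose =
      U * Matrix.diagonal E * U.transpose := by
    intro E
    simp [Matrix.transpose_mul, Matrix.mul_assoc]
  have hD : (fun i => D i * (D i)⁻¹ * D i) = D :=
    funext fun i => mul_inv_mul_cancel (D i)
  have hD' : (fun i => (D i)⁻¹ * D i * (D i)⁻¹) = fun i => (D i)⁻¹ :=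
    funext fun i => by simpa using mul_inv_mul_cancel (D i)⁻¹
  refine ⟨U * Matrix.diagonal (fun i => (D i)⁻¹) * U.transpose, ?_, ?_, ?_, ?_⟩
  · rw [h, key, key, hD]
  · rw [h, key, key, hD']
  · rw [h, key, symm]
  · rw [h, key, symm]

theorem isMoorePenrose_pseudoInverse {n : ℕ} (A : Matrix (Fin n) (Fin n) ℝ)
    (hA : A.IsHermitian) : IsMoorePenrose A (pseudoInverse A) := by
  have h := exists_isMoorePenrose A hA
  rw [pseudoInverse, dif_pos h]
  exact h.choose_spec

/-! ### Truncated likelihood and estimators -/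

/-- The matrix `[g (s_i - s_j)]`, of size `n`, based on the points `s`. -/
def kernelMatrix {d : ℕ} (g : Eucl d → ℝ) (n : ℕ) (s : ℕ → Eucl d) :
    Matrix (Fin n) (Fin n) ℝ :=
  Matrix.of fun i j => g (s i - s j)

/-- The truncated modified log-likelihood
`(1/n) log det₊ A + (1/n) ⟨z, A⁺ z⟩`, where `A` is the matrix `[g (s_i - s_j)]` of size `n` and
`z` is the vector of observations. -/
noncomputable def truncatedLogLik {d : ℕ} (g : Eucl d → ℝ) (n : ℕ) (s : ℕ → Eucl d)
    (z : ℕ → ℝ) : ℝ :=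
  1 / (n : ℝ) * Real.log (pseudoDet (kernelMatrix g n s)) +
    1 / (n : ℝ) * dotProduct (fun i : Fin n => z i)
      ((pseudoInverse (kernelMatrix g n s)).mulVec (fun i : Fin n => z i))

/-- `θhat` is a sequence of truncated maximum likelihood estimators, based on the approximations
`ctil` and the index sequence `r`, for the field `Z` observed at the random points `S`: for every
sample size `n ≥ 1`, almost surely, `θhat n` lies in `Θ` and minimizes the truncated modified
log-likelihood over `Θ`. -/
def IsTruncatedMLE {Ω : Type*} [MeasurableSpace Ω] (P : Measure Ω) {d p : ℕ} (Θ : Set (Eucl p))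
    (ctil : ℕ → Eucl p → Eucl d → ℝ) (r : ℕ → ℕ) (S : ℕ → Ω → Eucl d) (Z : Eucl d → Ω → ℝ)
    (θhat : ℕ → Ω → Eucl p) : Prop :=
  ∀ n, 1 ≤ n → ∀ᵐ ω ∂P, θhat n ω ∈ Θ ∧ ∀ θ ∈ Θ,
    truncatedLogLik (ctil (r n) (θhat n ω)) n (fun i => S i ω) (fun i => Z (S i ω) ω) ≤
      truncatedLogLik (ctil (r n) θ) n (fun i => S i ω) (fun i => Z (S i ω) ω)

/-!
Consistency of the truncated maximum likelihood estimator is proved by comparing likelihoods,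
where the likelihood `l_n` of a covariance matrix is `gaussLogLik`, the function to be minimized:
outside of a neighbourhood of `θ₀` it exceeds its value at `θ₀` by a fixed amount, with probability
tending to one, and the truncated likelihood of the approximations is uniformly close to it.

*Linear algebra.* Two positive definite matrices `A`, `B` are diagonalized simultaneously by a
congruence, `Pᵀ A P = 1` and `Pᵀ B P = diag μ` (`exists_isSimDiag`). In these coordinates
the difference of the likelihoods of `B` and `A` is `(1 / n) ∑ (log μ_k + (1 / μ_k - 1) η_k²)` with
`η = Pᵀ z` (`IsSimDiag.gaussLogLik_sub`). This gives the stability of the likelihood under small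
perturbations in operator norm (`abs_gaussLogLik_sub_le`). If `A` is the covariance matrix of
`z`, then the `η_k` are independent standard normal variables, the mean of the difference is at
least a multiple of the normalized squared Frobenius distance of `A` and `B`, and its variance is of
order `1 / n`; Chebyshev's inequality yields `measure_gaussLogLik_sub_lt_le`.

*Uniform bounds.* Since `τ < 1 / 2`, the sites are separated like lattice points. Bounded kernels
with compact support then give matrices of bounded operator norm (`exists_opNorm_bound`). Positivity
and continuity of the spectral densities give a uniform lower bound for the eigenvalues
(`exists_lower_bound`): a spectral density dominates a small multiple of a difference of two
Gaussians, the Fourier transform of which is explicit and concentrated on the diagonal. In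
particular the matrices of the approximations are positive definite for large `n`, so that
pseudo-determinant and pseudoinverse are the ordinary ones.

*Identifiability.* If `θ ≠ θ₀`, then `(c θ - c θ₀)²` is positive at the origin or at a possible
difference of two sites. A positive fraction of the sites can be arranged into disjoint pairs
with the corresponding integer difference, and the contributions of different pairs are
independent; hence the squared Frobenius distance of the two covariance matrices is at least of
order `n` (`exists_sum_sites_lower_bound`).

As the field and the displacements are independent, a bound for all deterministic displacements
carries over to the random ones (`IsFieldIndepOf.measure_le`). By the Lipschitz dependence on the
parameter, each `θ ≠ θ₀` has a neighbourhood that the estimator avoids with probability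
tending to one (`exists_tendsto_measure_mem_ball`), and compactness finishes the proof.
-/

open scoped Matrix

/-! ### Simultaneous diagonalization of two quadratic forms -/

/-- `P` and `μ` diagonalize the pair `(A, B)` simultaneously by congruence: `P` carries the form of
`A` to the standard one and the form of `B` to the diagonal one with coefficients `μ`. -/
structure IsSimDiag {n : ℕ} (A B P : Matrix (Fin n) (Fin n) ℝ) (μ : Fin n → ℝ) : Prop where
  left : Pᵀ * A * P = 1
  right : Pᵀ * B * P = Matrix.diagonal μ

theorem exists_orthogonal_diag {n : ℕ} {A : Matrix (Fin n) (Fin n) ℝ} (hA : A.IsHermitian) :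
    ∃ U : Matrix (Fin n) (Fin n) ℝ, Uᵀ * U = 1 ∧ Uᵀ * A * U = Matrix.diagonal hA.eigenvalues := by
  have hU : (hA.eigenvectorUnitary : Matrix (Fin n) (Fin n) ℝ)ᵀ * hA.eigenvectorUnitary = 1 := by
    have := Unitary.coe_star_mul_self hA.eigenvectorUnitary
    rwa [Matrix.star_eq_conjTranspose, Matrix.conjTranspose_eq_transpose_of_trivial] at this
  refine ⟨hA.eigenvectorUnitary, hU, ?_⟩
  have h := hA.spectral_theorem
  rw [Unitary.conjStarAlgAut_apply, Matrix.star_eq_conjTranspose,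
    Matrix.conjTranspose_eq_transpose_of_trivial] at h
  set U : Matrix (Fin n) (Fin n) ℝ := (hA.eigenvectorUnitary : Matrix (Fin n) (Fin n) ℝ)
  calc Uᵀ * A * U = Uᵀ * (U * Matrix.diagonal hA.eigenvalues * Uᵀ) * U := by
        conv_lhs => rw [h]
        rfl
    _ = (Uᵀ * U) * Matrix.diagonal hA.eigenvalues * (Uᵀ * U) := by simp only [Matrix.mul_assoc]
    _ = _ := by rw [hU]; simp

/-- A positive definite and a symmetric form can be diagonalized simultaneously: after `A` is
reduced to the identity, the transformed `B` is diagonalized by an orthogonal matrix. -/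
theorem exists_isSimDiag {n : ℕ} {A B : Matrix (Fin n) (Fin n) ℝ} (hA : A.PosDef)
    (hB : B.IsHermitian) : ∃ P μ, IsSimDiag A B P μ := by
  obtain ⟨U, hU, hUA⟩ := exists_orthogonal_diag hA.isHermitian
  set D : Matrix (Fin n) (Fin n) ℝ := Matrix.diagonal (fun i => (√(hA.isHermitian.eigenvalues i))⁻¹)
  have hDt : Dᵀ = D := Matrix.diagonal_transpose _
  have hD : D * Matrix.diagonal hA.isHermitian.eigenvalues * D = 1 := by
    simp only [D, Matrix.diagonal_mul_diagonal]
    rw [← Matrix.diagonal_one]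
    congr 1
    funext i
    have hi := hA.eigenvalues_pos i
    have hs := Real.sqrt_pos.2 hi
    have := Real.mul_self_sqrt hi.le
    field_simp
    nlinarith
  have hC : (D * (Uᵀ * B * U) * D).IsHermitian := by
    have hBt : Bᵀ = B := by simpa [Matrix.IsHermitian] using hB
    simp [Matrix.IsHermitian, Matrix.transpose_mul, hDt, hBt, Matrix.mul_assoc]
  obtain ⟨V, hV, hVC⟩ := exists_orthogonal_diag hC
  refine ⟨U * D * V, hC.eigenvalues, ?_, ?_⟩
  · calc (U * D * V)ᵀ * A * (U * D * V) = Vᵀ * (D * (Uᵀ * A * U) * D) * V := by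
          simp [Matrix.transpose_mul, hDt, Matrix.mul_assoc]
      _ = 1 := by rw [hUA, hD]; simpa using hV
  · rw [← hVC]
    simp [Matrix.transpose_mul, hDt, Matrix.mul_assoc]

namespace IsSimDiag

variable {n : ℕ} {A B P : Matrix (Fin n) (Fin n) ℝ} {μ : Fin n → ℝ}

theorem inv_left (h : IsSimDiag A B P μ) : A⁻¹ = P * Pᵀ := by
  apply Matrix.inv_eq_left_inv
  have := mul_eq_one_comm.1 h.left
  rwa [← Matrix.mul_assoc] at this

theorem inv_right (h : IsSimDiag A B P μ) (hμ : ∀ k, μ k ≠ 0) :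
    B⁻¹ = P * Matrix.diagonal (fun k => (μ k)⁻¹) * Pᵀ := by
  apply Matrix.inv_eq_left_inv
  have h1 : (Pᵀ * B) * (P * Matrix.diagonal (fun k => (μ k)⁻¹)) = 1 := by
    rw [← Matrix.mul_assoc, h.right, Matrix.diagonal_mul_diagonal, ← Matrix.diagonal_one]
    congr 1
    funext k
    exact mul_inv_cancel₀ (hμ k)
  have := mul_eq_one_comm.1 h1
  rwa [← Matrix.mul_assoc] at this

theorem det_right (h : IsSimDiag A B P μ) : B.det = A.det * ∏ k, μ k := by
  have h1 := congrArg Matrix.det h.left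
  have h2 := congrArg Matrix.det h.right
  simp only [Matrix.det_mul, Matrix.det_transpose, Matrix.det_one, Matrix.det_diagonal] at h1 h2
  rw [← h2]
  linear_combination (-B.det) * h1

theorem dotProduct_inv_left (h : IsSimDiag A B P μ) (z : Fin n → ℝ) :
    z ⬝ᵥ (A⁻¹ *ᵥ z) = ∑ k, ((Pᵀ *ᵥ z) k) ^ 2 := by
  rw [h.inv_left, ← Matrix.mulVec_mulVec, Matrix.dotProduct_mulVec, ← Matrix.mulVec_transpose]
  simp [dotProduct, sq]

theorem dotProduct_inv_right (h : IsSimDiag A B P μ) (hμ : ∀ k, μ k ≠ 0) (z : Fin n → ℝ) :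
    z ⬝ᵥ (B⁻¹ *ᵥ z) = ∑ k, (μ k)⁻¹ * ((Pᵀ *ᵥ z) k) ^ 2 := by
  rw [h.inv_right hμ, Matrix.mul_assoc, ← Matrix.mulVec_mulVec, Matrix.dotProduct_mulVec,
    ← Matrix.mulVec_transpose, ← Matrix.mulVec_mulVec]
  simp only [dotProduct, Matrix.mulVec_diagonal]
  exact Finset.sum_congr rfl fun k _ => by ring

theorem dotProduct_mulVec_col (M P : Matrix (Fin n) (Fin n) ℝ) (k : Fin n) :
    (P.col k) ⬝ᵥ (M *ᵥ P.col k) = (Pᵀ * M * P) k k := by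
  rw [Matrix.mul_assoc, Matrix.mul_apply']
  congr 1

theorem left_col (h : IsSimDiag A B P μ) (k : Fin n) : P.col k ⬝ᵥ (A *ᵥ P.col k) = 1 := by
  rw [dotProduct_mulVec_col, h.left, Matrix.one_apply_eq]

theorem right_col (h : IsSimDiag A B P μ) (k : Fin n) : P.col k ⬝ᵥ (B *ᵥ P.col k) = μ k := by
  rw [dotProduct_mulVec_col, h.right, Matrix.diagonal_apply_eq]

theorem pos (h : IsSimDiag A B P μ) (hB : B.PosDef) (k : Fin n) : 0 < μ k := by
  rw [← h.right_col k]
  have hne : P.col k ≠ 0 := by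
    intro h0
    have := h.left_col k
    rw [h0] at this
    simp at this
  simpa using hB.dotProduct_mulVec_pos hne

theorem log_det_right (h : IsSimDiag A B P μ) (hA : A.PosDef) (hB : B.PosDef) :
    Real.log B.det = Real.log A.det + ∑ k, Real.log (μ k) := by
  rw [h.det_right, Real.log_mul hA.det_pos.ne' (Finset.prod_pos fun k _ => h.pos hB k).ne',
    Real.log_prod fun k _ => (h.pos hB k).ne']

end IsSimDiag

/-- If `A ≤ M B` as quadratic forms, then `B⁻¹ ≤ M A⁻¹`. -/
theorem dotProduct_inv_le_of_le {n : ℕ} {A B : Matrix (Fin n) (Fin n) ℝ} (hA : A.PosDef)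
    (hB : B.PosDef) {M : ℝ} (h : ∀ x, x ⬝ᵥ (A *ᵥ x) ≤ M * (x ⬝ᵥ (B *ᵥ x))) (z : Fin n → ℝ) :
    z ⬝ᵥ (B⁻¹ *ᵥ z) ≤ M * (z ⬝ᵥ (A⁻¹ *ᵥ z)) := by
  obtain ⟨P, μ, hP⟩ := exists_isSimDiag hA hB.isHermitian
  have hμ := hP.pos hB
  rw [hP.dotProduct_inv_left, hP.dotProduct_inv_right fun k => (hμ k).ne', Finset.mul_sum]
  refine Finset.sum_le_sum fun k _ => mul_le_mul_of_nonneg_right ?_ (sq_nonneg _)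
  have := h (P.col k)
  rw [hP.left_col, hP.right_col] at this
  rw [inv_le_iff_one_le_mul₀ (hμ k)]
  exact this

theorem posDef_of_le {n : ℕ} {A : Matrix (Fin n) (Fin n) ℝ} (hA : A.IsHermitian) {lam : ℝ}
    (hlam : 0 < lam) (h : ∀ x, lam * (x ⬝ᵥ x) ≤ x ⬝ᵥ (A *ᵥ x)) : A.PosDef := by
  refine Matrix.PosDef.of_dotProduct_mulVec_pos hA fun x hx => ?_
  have h0 : 0 < x ⬝ᵥ x := by simpa using Matrix.dotProduct_star_self_pos_iff.2 hx
  simpa using lt_of_lt_of_le (mul_pos hlam h0) (h x)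

/-! ### Gaussian likelihoods -/

/-- The Gaussian log-likelihood (times `-2 / n`, and up to a constant) of the vector `z` under the
covariance matrix `A`. -/
noncomputable def gaussLogLik {n : ℕ} (A : Matrix (Fin n) (Fin n) ℝ) (z : Fin n → ℝ) : ℝ :=
  1 / (n : ℝ) * Real.log A.det + 1 / (n : ℝ) * (z ⬝ᵥ (A⁻¹ *ᵥ z))

/-- In the diagonalizing coordinates, the likelihoods of two covariance matrices differ by a sum of
one-dimensional terms. -/
theorem IsSimDiag.gaussLogLik_sub {n : ℕ} {A B P : Matrix (Fin n) (Fin n) ℝ} {μ : Fin n → ℝ}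
    (h : IsSimDiag A B P μ) (hA : A.PosDef) (hB : B.PosDef) (z : Fin n → ℝ) :
    gaussLogLik B z - gaussLogLik A z =
      1 / (n : ℝ) * ∑ k, (Real.log (μ k) + ((μ k)⁻¹ - 1) * ((Pᵀ *ᵥ z) k) ^ 2) := by
  rw [gaussLogLik, gaussLogLik, h.log_det_right hA hB, h.dotProduct_inv_left,
    h.dotProduct_inv_right fun k => (h.pos hB k).ne']
  simp only [sub_mul, one_mul, Finset.sum_add_distrib, Finset.sum_sub_distrib]
  ring

theorem pseudoDet_eq_det {n : ℕ} {A : Matrix (Fin n) (Fin n) ℝ} (hA : A.PosDef) :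
    pseudoDet A = A.det := by
  rw [pseudoDet, Matrix.det_eq_prod_roots_charpoly_of_splits hA.isHermitian.splits_charpoly,
    Multiset.filter_eq_self.2]
  intro x hx
  rw [hA.isHermitian.roots_charpoly_eq_eigenvalues] at hx
  obtain ⟨i, -, rfl⟩ := Multiset.mem_map.1 hx
  exact hA.eigenvalues_pos i

theorem pseudoInverse_eq_inv {n : ℕ} {A : Matrix (Fin n) (Fin n) ℝ} (hA : A.PosDef) :
    pseudoInverse A = A⁻¹ := by
  refine (isMoorePenrose_pseudoInverse A hA.isHermitian).unique ?_
  have hu : IsUnit A.det := hA.det_pos.ne'.isUnit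
  constructor <;> simp [Matrix.mul_nonsing_inv _ hu, Matrix.nonsing_inv_mul _ hu]

theorem truncatedLogLik_eq_gaussLogLik {d : ℕ} {g : Eucl d → ℝ} {n : ℕ} {s : ℕ → Eucl d}
    (hA : (kernelMatrix g n s).PosDef) (z : ℕ → ℝ) :
    truncatedLogLik g n s z = gaussLogLik (kernelMatrix g n s) (fun i => z i) := by
  rw [truncatedLogLik, gaussLogLik, pseudoDet_eq_det hA, pseudoInverse_eq_inv hA]

/-- Both hypotheses are needed: the first controls `x - 1`, the second `x⁻¹ - 1`. -/
theorem abs_log_le_of_abs_sub_one_le {x e : ℝ} (hx : 0 < x) (h1 : |x - 1| ≤ e)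
    (h2 : |x - 1| ≤ e * x) : |Real.log x| ≤ e := by
  have h3 := Real.log_le_sub_one_of_pos hx
  have h4 := Real.one_sub_inv_le_log_of_pos hx
  have h5 : x⁻¹ - 1 ≤ e := by
    rw [inv_eq_one_div, sub_le_iff_le_add, div_le_iff₀ hx]
    linarith [neg_abs_le (x - 1)]
  rw [abs_le]
  constructor <;> linarith [le_abs_self (x - 1)]

/-- Stability of the likelihood: if two covariance matrices are bounded below by `lam` and differ
by at most `e` in operator norm, then their likelihoods differ by at most a multiple of `e`. -/
theorem abs_gaussLogLik_sub_le {n : ℕ} (hn : 0 < n) {A B : Matrix (Fin n) (Fin n) ℝ} (hA : A.IsHermitian)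
    (hB : B.IsHermitian) {lam e : ℝ} (hlam : 0 < lam)
    (hA' : ∀ x, lam * (x ⬝ᵥ x) ≤ x ⬝ᵥ (A *ᵥ x)) (hB' : ∀ x, lam * (x ⬝ᵥ x) ≤ x ⬝ᵥ (B *ᵥ x))
    (hAB : ∀ x, |x ⬝ᵥ ((B - A) *ᵥ x)| ≤ e * (x ⬝ᵥ x)) (z : Fin n → ℝ) :
    |gaussLogLik B z - gaussLogLik A z| ≤
      e / lam * (1 + 1 / (n : ℝ) * (z ⬝ᵥ (A⁻¹ *ᵥ z))) := by
  have hAp := posDef_of_le hA hlam hA'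
  have hBp := posDef_of_le hB hlam hB'
  obtain ⟨P, μ, hP⟩ := exists_isSimDiag hAp hB
  have hμ := hP.pos hBp
  have hn' : (0 : ℝ) < n := by exact_mod_cast hn
  have hP0 : ∀ k, 0 ≤ P.col k ⬝ᵥ P.col k := fun k => by
    simpa [dotProduct] using Finset.sum_nonneg fun i _ => mul_self_nonneg (P.col k i)
  have he : ∀ k, |μ k - 1| ≤ e / lam ∧ |μ k - 1| ≤ e / lam * μ k := by
    intro k
    have h1 := hAB (P.col k)
    rw [Matrix.sub_mulVec, dotProduct_sub, hP.left_col, hP.right_col] at h1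
    have h2 := hA' (P.col k)
    have h3 := hB' (P.col k)
    rw [hP.left_col] at h2
    rw [hP.right_col] at h3
    have hpos : 0 < P.col k ⬝ᵥ P.col k := by
      refine lt_of_le_of_ne (hP0 k) fun h0 => ?_
      have h4 : P.col k = 0 := by simpa using h0.symm
      have h5 := hP.left_col k
      rw [h4] at h5
      simp at h5
    have he0 : 0 ≤ e := nonneg_of_mul_nonneg_left ((abs_nonneg _).trans h1) hpos
    rw [div_mul_eq_mul_div, le_div_iff₀ hlam, le_div_iff₀ hlam]
    constructor <;> nlinarith [mul_le_mul_of_nonneg_left h2 he0, mul_le_mul_of_nonneg_left h3 he0]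
  have h6 : ∀ k, |(μ k)⁻¹ - 1| ≤ e / lam := by
    intro k
    have h7 : (μ k)⁻¹ - 1 = -((μ k - 1) / μ k) := by field_simp [(hμ k).ne']; ring
    rw [h7, abs_neg, abs_div, abs_of_pos (hμ k), div_le_iff₀ (hμ k)]
    exact (he k).2
  rw [hP.gaussLogLik_sub hAp hBp, hP.dotProduct_inv_left, abs_mul, abs_of_pos (by positivity)]
  have h8 : |∑ k, (Real.log (μ k) + ((μ k)⁻¹ - 1) * ((Pᵀ *ᵥ z) k) ^ 2)| ≤
      ∑ k, (e / lam + e / lam * ((Pᵀ *ᵥ z) k) ^ 2) := by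
    refine (Finset.abs_sum_le_sum_abs _ _).trans (Finset.sum_le_sum fun k _ => ?_)
    refine (abs_add_le _ _).trans (add_le_add ?_ ?_)
    · exact abs_log_le_of_abs_sub_one_le (hμ k) (he k).1 (he k).2
    · rw [abs_mul, abs_of_nonneg (sq_nonneg ((Pᵀ *ᵥ z) k))]
      exact mul_le_mul_of_nonneg_right (h6 k) (sq_nonneg _)
  refine (mul_le_mul_of_nonneg_left h8 (by positivity)).trans (le_of_eq ?_)
  rw [Finset.sum_add_distrib, ← Finset.mul_sum]
  simp
  field_simp

/-- Conjugation by a matrix `Q` with `|Q x|² ≤ M |x|²` increases the Frobenius norm at most by the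
factor `M`. -/
theorem sum_sq_conj_diagonal_le {n : ℕ} {Q : Matrix (Fin n) (Fin n) ℝ} {M : ℝ} (hM : 0 ≤ M)
    (hQ : ∀ x, (Q *ᵥ x) ⬝ᵥ (Q *ᵥ x) ≤ M * (x ⬝ᵥ x)) (δ : Fin n → ℝ) :
    ∑ i, ∑ j, ((Qᵀ * Matrix.diagonal δ * Q) i j) ^ 2 ≤ M ^ 2 * ∑ k, (δ k) ^ 2 := by
  have hdot : ∀ x : Fin n → ℝ, x ⬝ᵥ x = ∑ k, x k ^ 2 := fun x => by simp [dotProduct, sq]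
  have hQt : ∀ y, (Qᵀ *ᵥ y) ⬝ᵥ (Qᵀ *ᵥ y) ≤ M * (y ⬝ᵥ y) := by
    intro y
    set u := Qᵀ *ᵥ y with hu
    have h1 : u ⬝ᵥ u = y ⬝ᵥ (Q *ᵥ u) := by
      rw [Matrix.dotProduct_mulVec y, ← Matrix.mulVec_transpose]
    have h2 : (y ⬝ᵥ (Q *ᵥ u)) ^ 2 ≤ (y ⬝ᵥ y) * ((Q *ᵥ u) ⬝ᵥ (Q *ᵥ u)) := by
      rw [hdot, hdot]
      exact Finset.sum_mul_sq_le_sq_mul_sq _ _ _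
    have h3 := hQ u
    have h4 : 0 ≤ u ⬝ᵥ u := by rw [hdot]; positivity
    have h5 : 0 ≤ y ⬝ᵥ y := by rw [hdot]; positivity
    rw [← h1] at h2
    rcases h4.eq_or_lt with h0 | h0
    · rw [← h0]; positivity
    · have : u ⬝ᵥ u * (u ⬝ᵥ u) ≤ (M * (y ⬝ᵥ y)) * (u ⬝ᵥ u) := by
        nlinarith [mul_le_mul_of_nonneg_left h3 h5]
      exact le_of_mul_le_mul_right this h0
  -- one multiplication by `Qᵀ` acts on the columns, the other one on the rows
  set Y := Matrix.diagonal δ * Q with hY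
  have h1 : ∑ i, ∑ j, ((Qᵀ * Y) i j) ^ 2 ≤ M * ∑ i, ∑ j, (Y i j) ^ 2 := by
    rw [Finset.sum_comm, Finset.sum_comm (f := fun i j => (Y i j) ^ 2), Finset.mul_sum]
    refine Finset.sum_le_sum fun j _ => ?_
    have := hQt (Y.col j)
    rw [hdot, hdot] at this
    exact this
  have h2 : ∑ i, ∑ j, (Y i j) ^ 2 ≤ M * ∑ k, (δ k) ^ 2 := by
    rw [Finset.mul_sum]
    refine Finset.sum_le_sum fun i _ => ?_
    have := hQt (Pi.single i (δ i))
    rw [hdot, hdot] at this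
    have h3 : ∀ j, Y i j = (Qᵀ *ᵥ Pi.single i (δ i)) j := by
      intro j
      simp [hY, Matrix.diagonal_mul, Matrix.mulVec_single, mul_comm]
    simp only [h3]
    refine this.trans (le_of_eq ?_)
    congr 1
    rw [Finset.sum_eq_single i] <;> simp +contextual
  rw [Matrix.mul_assoc, ← hY]
  calc _ ≤ M * (M * ∑ k, (δ k) ^ 2) := h1.trans (mul_le_mul_of_nonneg_left h2 hM)
    _ = _ := by ring

/-- The squared Frobenius distance of `A` and `B` in terms of the relative eigenvalues `μ`. -/
theorem IsSimDiag.sum_sq_sub_le {n : ℕ} {A B P : Matrix (Fin n) (Fin n) ℝ} {μ : Fin n → ℝ}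
    (h : IsSimDiag A B P μ) {M : ℝ} (hM : 0 ≤ M) (hA : ∀ x, x ⬝ᵥ (A *ᵥ x) ≤ M * (x ⬝ᵥ x)) :
    ∑ i, ∑ j, (B i j - A i j) ^ 2 ≤ M ^ 2 * ∑ k, (μ k - 1) ^ 2 := by
  have hdet : IsUnit P.det := by
    have h1 := congrArg Matrix.det h.left
    simp only [Matrix.det_mul, Matrix.det_one] at h1
    exact IsUnit.of_mul_eq_one_right _ h1
  have hPQ : P * P⁻¹ = 1 := Matrix.mul_nonsing_inv _ hdet
  have hQP : (P⁻¹)ᵀ * Pᵀ = 1 := by rw [← Matrix.transpose_mul, hPQ, Matrix.transpose_one]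
  have hrec : ∀ C : Matrix (Fin n) (Fin n) ℝ, (P⁻¹)ᵀ * (Pᵀ * C * P) * P⁻¹ = C := by
    intro C
    calc _ = ((P⁻¹)ᵀ * Pᵀ) * C * (P * P⁻¹) := by simp only [Matrix.mul_assoc]
      _ = C := by rw [hPQ, hQP]; simp
  have hQ : ∀ x, (P⁻¹ *ᵥ x) ⬝ᵥ (P⁻¹ *ᵥ x) ≤ M * (x ⬝ᵥ x) := by
    intro x
    refine le_trans (le_of_eq ?_) (hA x)
    conv_rhs => rw [← hrec A, h.left, Matrix.mul_one]
    rw [← Matrix.mulVec_mulVec, Matrix.dotProduct_mulVec x, ← Matrix.mulVec_transpose,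
      Matrix.transpose_transpose]
  have hBA : B - A = (P⁻¹)ᵀ * Matrix.diagonal (fun k => μ k - 1) * P⁻¹ := by
    have h1 : Matrix.diagonal (fun k => μ k - 1) = Pᵀ * (B - A) * P := by
      rw [Matrix.mul_sub, Matrix.sub_mul, h.left, h.right, ← Matrix.diagonal_one,
        Matrix.diagonal_sub]
    rw [h1, hrec]
  have := sum_sq_conj_diagonal_le hM hQ (fun k => μ k - 1)
  rw [← hBA] at this
  exact this

/-! ### Concentration of Gaussian quadratic forms -/

/-- The variance of `η ^ 2` for a standard normal variable `η`. -/
noncomputable def chiSqVariance : ℝ := Var[fun x : ℝ => x ^ 2; gaussianReal 0 1]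

theorem chiSqVariance_nonneg : 0 ≤ chiSqVariance := variance_nonneg _ _

theorem memLp_sq_gaussianReal : MemLp (fun x : ℝ => x ^ 2) 2 (gaussianReal 0 1) := by
  have h := memLp_id_gaussianReal' (μ := 0) (v := 1) (4 : ENNReal) (by norm_num)
  refine (memLp_two_iff_integrable_sq (by fun_prop)).2 ?_
  have h4 := h.integrable_norm_pow (p := 4) (by norm_num)
  refine h4.congr (ae_of_all _ fun x => ?_)
  simp only [id, Real.norm_eq_abs]
  rw [← pow_mul]
  exact (show Even (2 * 2) by decide).pow_abs x

theorem integral_sq_gaussianReal : ∫ x : ℝ, x ^ 2 ∂(gaussianReal 0 1) = 1 := by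
  have h := variance_id_gaussianReal (μ := 0) (v := 1)
  rw [variance_of_integral_eq_zero (by fun_prop) (by simp)] at h
  simpa using h

/-- Whitening: if `Pᵀ A P = 1`, where `A` is the covariance matrix of the centred Gaussian vector
`ζ`, then the coordinates of `Pᵀ ζ` are independent standard normal variables. -/
theorem iIndepFun_whitened {Ω : Type*} [MeasurableSpace Ω] {μ : Measure Ω} {n : ℕ}
    {ζ : Fin n → Ω → ℝ} (hζ : IsGaussianProcess ζ μ) (h0 : ∀ i, ∫ ω, ζ i ω ∂μ = 0)
    {A P : Matrix (Fin n) (Fin n) ℝ} (hA : ∀ i j, cov[ζ i, ζ j; μ] = A i j)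
    (hP : Pᵀ * A * P = 1) :
    iIndepFun (fun k ω => (Pᵀ *ᵥ fun i => ζ i ω) k) μ ∧
      ∀ k, μ.map (fun ω => (Pᵀ *ᵥ fun i => ζ i ω) k) = gaussianReal 0 1 := by
  have := hζ.isProbabilityMeasure
  have hL2 : ∀ i, MemLp (ζ i) 2 μ := fun i => (hζ.hasGaussianLaw_eval i).memLp_two
  have hcov : ∀ k l, cov[fun ω => (Pᵀ *ᵥ fun i => ζ i ω) k, fun ω => (Pᵀ *ᵥ fun i => ζ i ω) l; μ]
      = (1 : Matrix (Fin n) (Fin n) ℝ) k l := by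
    intro k l
    simp only [Matrix.mulVec, dotProduct, Matrix.transpose_apply]
    rw [covariance_fun_sum_fun_sum (fun i => (hL2 i).const_mul _) (fun i => (hL2 i).const_mul _),
      ← hP]
    simp only [Matrix.mul_apply, Matrix.transpose_apply, Finset.sum_mul]
    rw [Finset.sum_comm]
    refine Finset.sum_congr rfl fun i _ => Finset.sum_congr rfl fun j _ => ?_
    rw [covariance_const_mul_left, covariance_const_mul_right, hA]
    ring
  have hproc : IsGaussianProcess (fun k ω => (Pᵀ *ᵥ fun i => ζ i ω) k) μ := by
    refine hζ.of_isGaussianProcess fun k => ⟨Finset.univ,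
      ∑ i, (Pᵀ k i) • ContinuousLinearMap.proj (R := ℝ) ⟨i, Finset.mem_univ i⟩, fun ω => ?_⟩
    simp [Matrix.mulVec, dotProduct]
  constructor
  · have hlaw : HasGaussianLaw (fun ω k => (Pᵀ *ᵥ fun i => ζ i ω) k) μ := by
      have h1 := (hproc.hasGaussianLaw Finset.univ).map_fun
        (ContinuousLinearMap.pi fun k : Fin n =>
          ContinuousLinearMap.proj (R := ℝ) (φ := fun _ : (Finset.univ : Finset (Fin n)) => ℝ)
            ⟨k, Finset.mem_univ k⟩)
      exact h1
    refine hlaw.iIndepFun_of_covariance_eq_zero fun k l hkl => ?_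
    rw [hcov, Matrix.one_apply_ne hkl]
  · intro k
    have hk := hproc.hasGaussianLaw_eval k
    rw [hk.map_eq_gaussianReal, ← covariance_self hk.aemeasurable, hcov, Matrix.one_apply_eq]
    have hmean : ∫ ω, (Pᵀ *ᵥ fun i => ζ i ω) k ∂μ = 0 := by
      simp only [Matrix.mulVec, dotProduct]
      rw [integral_finsetSum _ fun i _ => ((hL2 i).integrable (by norm_num)).const_mul _]
      simp [integral_const_mul, h0]
    rw [hmean, Real.toNNReal_one]

/-- Chebyshev's inequality for a weighted sum of centred squares of independent standard normal
variables. -/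
theorem measure_weighted_sq_ge_le {Ω : Type*} [MeasurableSpace Ω] {μ : Measure Ω}
    [IsProbabilityMeasure μ] {n : ℕ} {η : Fin n → Ω → ℝ} (hind : iIndepFun η μ)
    (hη : ∀ k, AEMeasurable (η k) μ) (hlaw : ∀ k, μ.map (η k) = gaussianReal 0 1)
    (a : Fin n → ℝ) {t : ℝ} (ht : 0 < t) :
    μ {ω | t ≤ |∑ k, a k * (η k ω ^ 2 - 1)|} ≤
      ENNReal.ofReal (chiSqVariance * ∑ k, a k ^ 2 / t ^ 2) := by
  have hsq : ∀ k, MemLp (fun ω => η k ω ^ 2) 2 μ := fun k => by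
    have := memLp_sq_gaussianReal
    rw [← hlaw k] at this
    exact this.comp_of_map (hη k)
  have hint : ∀ k, ∫ ω, η k ω ^ 2 ∂μ = 1 := fun k => by
    rw [← integral_sq_gaussianReal, ← hlaw k, integral_map (hη k) (by fun_prop)]
  have hvar : ∀ k, Var[fun ω => η k ω ^ 2; μ] = chiSqVariance := fun k => by
    rw [chiSqVariance, ← hlaw k, variance_map (by fun_prop) (hη k)]
    rfl
  have hY : ∀ k, MemLp (fun ω => a k * η k ω ^ 2) 2 μ := fun k => (hsq k).const_mul _
  have hsum : Var[∑ k, fun ω => a k * η k ω ^ 2; μ] = ∑ k, a k ^ 2 * chiSqVariance := by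
    rw [IndepFun.variance_sum (fun k _ => hY k)]
    · exact Finset.sum_congr rfl fun k _ => by rw [variance_const_mul, hvar]
    · intro k _ l _ hkl
      exact (hind.indepFun hkl).comp (φ := fun x => a k * x ^ 2) (ψ := fun x => a l * x ^ 2)
        (by fun_prop) (by fun_prop)
  have hmean : ∫ ω, (∑ k, fun ω => a k * η k ω ^ 2) ω ∂μ = ∑ k, a k := by
    simp only [Finset.sum_apply]
    rw [integral_finsetSum _ fun k _ => (hY k).integrable (by norm_num)]
    simp [integral_const_mul, hint]
  have hcheb := meas_ge_le_variance_div_sq (memLp_finsetSum' Finset.univ fun k _ => hY k) ht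
  rw [hsum, hmean] at hcheb
  refine le_trans (le_of_eq ?_) (hcheb.trans (le_of_eq ?_))
  · congr 1
    ext ω
    simp [mul_sub, Finset.sum_sub_distrib]
  · rw [Finset.sum_div, Finset.mul_sum]
    congr 1
    exact Finset.sum_congr rfl fun k _ => by ring

/-- `y - 1 - log y` is bounded below by a quadratic function on bounded intervals. -/
theorem sq_le_sub_log {y Y : ℝ} (hy : 0 < y) (hyY : y ≤ Y) :
    (y - 1) ^ 2 ≤ (√Y + 1) ^ 2 * (y - 1 - Real.log y) := by
  have hs := Real.sqrt_pos.2 hy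
  have h1 : Real.log y ≤ 2 * (√y - 1) := by
    have h2 := Real.log_le_sub_one_of_pos hs
    rw [Real.log_sqrt hy.le] at h2
    linarith
  have h3 : (√y - 1) ^ 2 ≤ y - 1 - Real.log y := by nlinarith [Real.sq_sqrt hy.le]
  have h4 : (y - 1) ^ 2 = (√y + 1) ^ 2 * (√y - 1) ^ 2 := by
    nth_rewrite 1 [← Real.sq_sqrt hy.le]
    ring
  have h5 : (√y + 1) ^ 2 ≤ (√Y + 1) ^ 2 := by
    have := Real.sqrt_le_sqrt hyY
    gcongr
  rw [h4]
  exact mul_le_mul h5 h3 (sq_nonneg _) (sq_nonneg _)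

/-- Under the covariance matrix `A`, the vector `z` has the likelihood of `B` exceeding that of `A`
by a fixed amount, unless `A` and `B` are close on average; the exceptional probability is of
order `1 / n`. -/
theorem measure_gaussLogLik_sub_lt_le {lam Lam : ℝ} (hlam : 0 < lam) (hLam : 0 < Lam) :
    ∃ κ > 0, ∃ K : ℝ, 0 ≤ K ∧ ∀ {Ω : Type*} [MeasurableSpace Ω] {μ : Measure Ω} {n : ℕ}
      {ζ : Fin n → Ω → ℝ} {A B : Matrix (Fin n) (Fin n) ℝ}, 0 < n →
      IsGaussianProcess ζ μ → (∀ i, ∫ ω, ζ i ω ∂μ = 0) → (∀ i j, cov[ζ i, ζ j; μ] = A i j) →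
      A.IsHermitian → B.IsHermitian →
      (∀ x, lam * (x ⬝ᵥ x) ≤ x ⬝ᵥ (A *ᵥ x)) → (∀ x, x ⬝ᵥ (A *ᵥ x) ≤ Lam * (x ⬝ᵥ x)) →
      (∀ x, lam * (x ⬝ᵥ x) ≤ x ⬝ᵥ (B *ᵥ x)) → (∀ x, x ⬝ᵥ (B *ᵥ x) ≤ Lam * (x ⬝ᵥ x)) →
      ∀ δ > 0, n * δ ≤ ∑ i, ∑ j, (B i j - A i j) ^ 2 →
      μ {ω | gaussLogLik B (fun i => ζ i ω) - gaussLogLik A (fun i => ζ i ω) < κ * δ} ≤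
        ENNReal.ofReal (K / (n * δ)) := by
  set R := Lam / lam with hR
  have hR0 : 0 < R := div_pos hLam hlam
  set c := (√R + 1) ^ 2 with hc
  have hc0 : 0 < c := by positivity
  set Q := Lam ^ 2 * R ^ 2 with hQ
  have hQ0 : 0 < Q := by positivity
  refine ⟨1 / (2 * c * Q), by positivity, 4 * c ^ 2 * Q * chiSqVariance,
    mul_nonneg (by positivity) chiSqVariance_nonneg, ?_⟩
  intro Ω _ μ n ζ A B hn hζ h0 hcov hA hB hA1 hA2 hB1 hB2 δ hδ hF
  have := hζ.isProbabilityMeasure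
  have hAp := posDef_of_le hA hlam hA1
  have hBp := posDef_of_le hB hlam hB1
  obtain ⟨P, ν, hP⟩ := exists_isSimDiag hAp hB
  obtain ⟨hind, hlaw⟩ := iIndepFun_whitened hζ h0 hcov hP.left
  have hν := hP.pos hBp
  have hn' : (0 : ℝ) < n := by exact_mod_cast hn
  have hmeas : ∀ k, AEMeasurable (fun ω => (Pᵀ *ᵥ fun i => ζ i ω) k) μ := fun k =>
    AEMeasurable.of_map_ne_zero (by rw [hlaw]; exact IsProbabilityMeasure.ne_zero _)
  have hνR : ∀ k, ν k ≤ R ∧ (ν k)⁻¹ ≤ R := by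
    intro k
    have h1 := hA1 (P.col k)
    have h2 := hA2 (P.col k)
    have h3 := hB1 (P.col k)
    have h4 := hB2 (P.col k)
    rw [hP.left_col] at h1 h2
    rw [hP.right_col] at h3 h4
    rw [inv_le_iff_one_le_mul₀ (hν k), hR, div_mul_eq_mul_div, le_div_iff₀ hlam, le_div_iff₀ hlam]
    constructor <;> nlinarith
  set a : Fin n → ℝ := fun k => (ν k)⁻¹ - 1 with ha
  set S := ∑ k, a k ^ 2 with hS
  -- the squared Frobenius distance controls `S`, and `S` controls mean and variance
  have hSlow : n * δ ≤ Q * S := by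
    refine hF.trans ((hP.sum_sq_sub_le hLam.le hA2).trans ?_)
    rw [hQ, mul_assoc, hS, Finset.mul_sum _ _ (R ^ 2)]
    refine mul_le_mul_of_nonneg_left (Finset.sum_le_sum fun k _ => ?_) (by positivity)
    have h5 : ν k - 1 = -(ν k * a k) := by
      simp only [ha]
      field_simp [(hν k).ne']
      ring
    rw [h5, neg_sq, mul_pow]
    have := (hνR k).1
    have := (hν k).le
    gcongr
  have hS0 : 0 < S := by
    have : 0 < Q * S := lt_of_lt_of_le (by positivity) hSlow
    exact pos_of_mul_pos_right this hQ0.le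
  have hmean : S ≤ c * ∑ k, (Real.log (ν k) + a k) := by
    rw [hS, Finset.mul_sum]
    refine Finset.sum_le_sum fun k _ => ?_
    have h6 := sq_le_sub_log (inv_pos.2 (hν k)) (hνR k).2
    rw [Real.log_inv] at h6
    calc a k ^ 2 ≤ _ := h6
      _ = _ := by rw [hc]; ring
  have ht : 0 < S / (2 * c) := by positivity
  have h := measure_weighted_sq_ge_le hind hmeas hlaw a ht
  refine (measure_mono fun ω hω => ?_).trans (h.trans (ENNReal.ofReal_le_ofReal ?_))
  · simp only [Set.mem_ofPred_eq] at hω ⊢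
    rw [hP.gaussLogLik_sub hAp hBp, one_div, inv_mul_eq_div, div_lt_iff₀ hn'] at hω
    refine le_trans ?_ (neg_le_abs _)
    set η := Pᵀ *ᵥ fun i => ζ i ω
    have h7 : ∑ k, (Real.log (ν k) + ((ν k)⁻¹ - 1) * η k ^ 2) =
        ∑ k, (Real.log (ν k) + a k) + ∑ k, a k * (η k ^ 2 - 1) := by
      rw [← Finset.sum_add_distrib]
      exact Finset.sum_congr rfl fun k _ => by simp only [ha]; ring
    rw [h7] at hω
    have h8 : S / c ≤ ∑ k, (Real.log (ν k) + a k) := by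
      rw [div_le_iff₀ hc0]; linarith
    have h9 : 1 / (2 * c * Q) * δ * n ≤ S / (2 * c) := by
      rw [le_div_iff₀ (by positivity)]
      have : 1 / (2 * c * Q) * δ * n * (2 * c) = (n * δ) / Q := by field_simp
      rw [this, div_le_iff₀ hQ0]
      linarith
    have h10 : S / c = S / (2 * c) + S / (2 * c) := by field_simp; ring
    linarith
  · rw [← Finset.sum_div, ← hS]
    have h11 : chiSqVariance * (S / (S / (2 * c)) ^ 2) = 4 * c ^ 2 * chiSqVariance / S := by
      field_simp
      norm_num
    rw [h11, div_le_div_iff₀ hS0 (by positivity)]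
    have h12 : 0 ≤ 4 * c ^ 2 * chiSqVariance := mul_nonneg (by positivity) chiSqVariance_nonneg
    nlinarith [mul_le_mul_of_nonneg_left hSlow h12]

/-- The normalized quadratic form `zᵀ A⁻¹ z / n` is at most `2` with high probability. -/
theorem measure_quadForm_gt_le {Ω : Type*} [MeasurableSpace Ω] {μ : Measure Ω} {n : ℕ}
    {ζ : Fin n → Ω → ℝ} {A : Matrix (Fin n) (Fin n) ℝ} (hn : 0 < n) (hζ : IsGaussianProcess ζ μ)
    (h0 : ∀ i, ∫ ω, ζ i ω ∂μ = 0) (hcov : ∀ i j, cov[ζ i, ζ j; μ] = A i j) (hA : A.PosDef) :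
    μ {ω | 2 < 1 / (n : ℝ) * ((fun i => ζ i ω) ⬝ᵥ (A⁻¹ *ᵥ fun i => ζ i ω))} ≤
      ENNReal.ofReal (chiSqVariance / n) := by
  have := hζ.isProbabilityMeasure
  obtain ⟨P, ν, hP⟩ := exists_isSimDiag hA hA.isHermitian
  obtain ⟨hind, hlaw⟩ := iIndepFun_whitened hζ h0 hcov hP.left
  have hn' : (0 : ℝ) < n := by exact_mod_cast hn
  have hmeas : ∀ k, AEMeasurable (fun ω => (Pᵀ *ᵥ fun i => ζ i ω) k) μ := fun k =>
    AEMeasurable.of_map_ne_zero (by rw [hlaw]; exact IsProbabilityMeasure.ne_zero _)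
  have h := measure_weighted_sq_ge_le hind hmeas hlaw (fun _ => 1) hn'
  refine (measure_mono fun ω hω => ?_).trans (h.trans (le_of_eq ?_))
  · simp only [Set.mem_ofPred_eq] at hω ⊢
    rw [hP.dotProduct_inv_left, one_div, inv_mul_eq_div, lt_div_iff₀ hn'] at hω
    refine le_trans ?_ (le_abs_self _)
    simp only [one_mul, Finset.sum_sub_distrib]
    simp
    linarith
  · congr 1
    simp
    field_simp

/-! ### Kernel matrices on separated points -/

theorem dotProduct_kernelMatrix {d n : ℕ} (g : Eucl d → ℝ) (s : ℕ → Eucl d) (x : Fin n → ℝ) :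
    x ⬝ᵥ (kernelMatrix g n s *ᵥ x) = ∑ i : Fin n, ∑ j : Fin n, x i * x j * g (s i - s j) := by
  simp only [dotProduct, Matrix.mulVec, kernelMatrix, Matrix.of_apply, Finset.mul_sum]
  exact Finset.sum_congr rfl fun i _ => Finset.sum_congr rfl fun j _ => by ring

theorem kernelMatrix_isHermitian {d : ℕ} {g : Eucl d → ℝ} (hg : ∀ s, g (-s) = g s) (n : ℕ)
    (s : ℕ → Eucl d) : (kernelMatrix g n s).IsHermitian := by
  ext i j
  simp only [Matrix.conjTranspose_apply, kernelMatrix, Matrix.of_apply, star_trivial]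
  rw [← hg, neg_sub]

/-- **Schur test** for a matrix dominated by a symmetric one with bounded row sums. -/
theorem abs_dotProduct_mulVec_le {n : ℕ} {M W : Matrix (Fin n) (Fin n) ℝ} {R : ℝ}
    (hMW : ∀ i j, |M i j| ≤ W i j) (hW : ∀ i j, W i j = W j i) (hR : ∀ i, ∑ j, W i j ≤ R)
    (x : Fin n → ℝ) : |x ⬝ᵥ (M *ᵥ x)| ≤ R * (x ⬝ᵥ x) := by
  have h1 : |x ⬝ᵥ (M *ᵥ x)| ≤ ∑ i, ∑ j, W i j * ((x i ^ 2 + x j ^ 2) / 2) := by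
    simp only [dotProduct, Matrix.mulVec, Finset.mul_sum]
    refine (Finset.abs_sum_le_sum_abs _ _).trans (Finset.sum_le_sum fun i _ => ?_)
    refine (Finset.abs_sum_le_sum_abs _ _).trans (Finset.sum_le_sum fun j _ => ?_)
    rw [show x i * (M i j * x j) = M i j * (x i * x j) by ring, abs_mul]
    refine mul_le_mul (hMW i j) ?_ (abs_nonneg _) ((abs_nonneg _).trans (hMW i j))
    rw [abs_le]
    constructor <;> nlinarith [sq_nonneg (x i + x j), sq_nonneg (x i - x j)]
  have h2 : ∑ i, ∑ j, W i j * ((x i ^ 2 + x j ^ 2) / 2) = ∑ i, x i ^ 2 * ∑ j, W i j := by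
    have h3 : ∑ i, ∑ j, W i j * (x j ^ 2 / 2) = ∑ i, ∑ j, W i j * (x i ^ 2 / 2) := by
      rw [Finset.sum_comm]
      exact Finset.sum_congr rfl fun i _ => Finset.sum_congr rfl fun j _ => by rw [hW]
    have h4 : ∑ i, ∑ j, W i j * ((x i ^ 2 + x j ^ 2) / 2) =
        ∑ i, ∑ j, W i j * (x i ^ 2 / 2) + ∑ i, ∑ j, W i j * (x j ^ 2 / 2) := by
      simp only [← Finset.sum_add_distrib]
      exact Finset.sum_congr rfl fun i _ => Finset.sum_congr rfl fun j _ => by ring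
    rw [h4, h3, ← Finset.sum_add_distrib]
    refine Finset.sum_congr rfl fun i _ => ?_
    rw [← Finset.sum_add_distrib, Finset.mul_sum]
    exact Finset.sum_congr rfl fun j _ => by ring
  rw [h2] at h1
  refine h1.trans ?_
  rw [dotProduct, Finset.mul_sum]
  refine Finset.sum_le_sum fun i _ => ?_
  nlinarith [mul_le_mul_of_nonneg_left (hR i) (sq_nonneg (x i))]

/-- The `ℓ¹`-distance of two integer vectors. -/
def latticeDist {d : ℕ} (z w : Fin d → ℤ) : ℝ := ∑ k, |(z k - w k : ℝ)|

theorem latticeDist_comm {d : ℕ} (z w : Fin d → ℤ) : latticeDist z w = latticeDist w z :=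
  Finset.sum_congr rfl fun _ _ => abs_sub_comm _ _

theorem summable_exp_neg_abs_int : Summable fun t : ℤ => Real.exp (-|(t : ℝ)|) := by
  refine Summable.of_nat_of_neg ?_ ?_
  · simpa using Real.summable_exp_neg_nat
  · simpa using Real.summable_exp_neg_nat

/-- Exponential sums over distinct lattice points are bounded, uniformly in their number. -/
theorem exists_sum_exp_latticeDist_le (d : ℕ) : ∃ K : ℝ, 0 < K ∧ ∀ {n : ℕ}
    (w : Fin n → Fin d → ℤ), Function.Injective w → ∀ i,
      ∑ j, Real.exp (-latticeDist (w i) (w j)) ≤ K := by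
  have hT : 0 < ∑' t : ℤ, Real.exp (-|(t : ℝ)|) :=
    summable_exp_neg_abs_int.tsum_pos (fun t => (Real.exp_pos _).le) 0 (Real.exp_pos _)
  refine ⟨(∑' t : ℤ, Real.exp (-|(t : ℝ)|)) ^ d, by positivity, fun {n} w hw i => ?_⟩
  classical
  set F : Fin d → Finset ℤ := fun k => Finset.univ.image fun j => w i k - w j k
  have hinj : Function.Injective fun j => w i - w j := fun a b hab => hw (sub_right_injective hab)
  calc ∑ j, Real.exp (-latticeDist (w i) (w j))
      = ∑ j, ∏ k, Real.exp (-|(((w i - w j) k : ℤ) : ℝ)|) := by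
        refine Finset.sum_congr rfl fun j _ => ?_
        rw [← Real.exp_sum, Finset.sum_neg_distrib]
        simp [latticeDist]
    _ = ∑ z ∈ Finset.univ.image fun j => w i - w j, ∏ k, Real.exp (-|((z k : ℤ) : ℝ)|) := by
        rw [Finset.sum_image fun a _ b _ hab => hinj hab]
    _ ≤ ∑ z ∈ Fintype.piFinset F, ∏ k, Real.exp (-|((z k : ℤ) : ℝ)|) := by
        refine Finset.sum_le_sum_of_subset_of_nonneg ?_ fun _ _ _ => by positivity
        intro z hz
        obtain ⟨j, -, rfl⟩ := Finset.mem_image.1 hz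
        exact Fintype.mem_piFinset.2 fun k =>
          Finset.mem_image.2 ⟨j, Finset.mem_univ j, rfl⟩
    _ = ∏ k, ∑ t ∈ F k, Real.exp (-|(t : ℝ)|) := 
        (Finset.prod_univ_sum F fun _ t => Real.exp (-|(t : ℝ)|)).symm
    _ ≤ ∏ _k : Fin d, ∑' t : ℤ, Real.exp (-|(t : ℝ)|) := by
        refine Finset.prod_le_prod (fun _ _ => Finset.sum_nonneg fun _ _ => (Real.exp_pos _).le)
          fun k _ => ?_
        exact summable_exp_neg_abs_int.sum_le_tsum _ fun _ _ => (Real.exp_pos _).le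
    _ = _ := by simp

/-- The points `s i` are separated like the distinct lattice points `w i`, up to the factor `ρ` in
every coordinate. -/
structure IsSpread {d : ℕ} (ρ : ℝ) (w : ℕ → Fin d → ℤ) (s : ℕ → Eucl d) : Prop where
  injective : Function.Injective w
  le : ∀ i j k, ρ * |(w i k - w j k : ℝ)| ≤ |s i k - s j k|

theorem IsSpread.injective_fin {d : ℕ} {ρ : ℝ} {w : ℕ → Fin d → ℤ} {s : ℕ → Eucl d}
    (h : IsSpread ρ w s) (n : ℕ) : Function.Injective fun i : Fin n => w i :=
  h.injective.comp Fin.val_injective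

/-- A matrix with entries bounded by `e`, and vanishing for pairs of points at distance more than
`C`, has operator norm at most a constant times `e`. -/
theorem exists_opNorm_bound (d : ℕ) {ρ : ℝ} (hρ : 0 < ρ) (C : ℝ) : ∃ N : ℝ, 0 < N ∧
    ∀ {n : ℕ} {w : ℕ → Fin d → ℤ} {s : ℕ → Eucl d}, IsSpread ρ w s →
    ∀ {M : Matrix (Fin n) (Fin n) ℝ} {e : ℝ}, (∀ i j, |M i j| ≤ e) →
      (∀ i j : Fin n, C < ‖s i - s j‖ → M i j = 0) → 0 ≤ e →
      ∀ x, |x ⬝ᵥ (M *ᵥ x)| ≤ N * e * (x ⬝ᵥ x) := by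
  obtain ⟨K, hK, hsum⟩ := exists_sum_exp_latticeDist_le d
  refine ⟨Real.exp (d * (C / ρ)) * K, by positivity, ?_⟩
  intro n w s hs M e hM hM0 he x
  refine abs_dotProduct_mulVec_le (W := fun i j =>
    e * Real.exp (d * (C / ρ)) * Real.exp (-latticeDist (w i) (w j))) ?_ ?_ ?_ x
  · intro i j
    rcases lt_or_ge C ‖s i - s j‖ with hC | hC
    · rw [hM0 i j hC, abs_zero]; positivity
    · refine (hM i j).trans ?_
      rw [mul_assoc, ← Real.exp_add]
      refine le_mul_of_one_le_right he (Real.one_le_exp ?_)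
      have h1 : latticeDist (w i) (w j) ≤ ∑ _k : Fin d, C / ρ := by
        refine Finset.sum_le_sum fun k _ => ?_
        rw [le_div_iff₀ hρ, mul_comm]
        refine (hs.le i j k).trans (le_trans ?_ hC)
        simpa using PiLp.norm_apply_le (s i - s j) k
      simp at h1
      linarith
  · intro i j
    simp only [latticeDist_comm]
  · intro i
    rw [← Finset.mul_sum]
    have h2 := hsum _ (hs.injective_fin n) i
    calc _ ≤ e * Real.exp (d * (C / ρ)) * K := by gcongr
      _ = _ := by ring

/-- The function `s ↦ exp (-b |s|²)`. -/
noncomputable def gaussKernel {d : ℕ} (b : ℝ) (s : Eucl d) : ℝ := Real.exp (-b * ‖s‖ ^ 2)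

/-- The matrix of a narrow Gaussian kernel on separated points is close to the identity. -/
theorem exists_gaussKernel_near_one (d : ℕ) {ρ : ℝ} (hρ : 0 < ρ) : ∃ b₀ : ℝ, 0 < b₀ ∧
    ∀ b ≥ b₀, ∀ {n : ℕ} {w : ℕ → Fin d → ℤ} {s : ℕ → Eucl d}, IsSpread ρ w s →
      ∀ x : Fin n → ℝ, |x ⬝ᵥ ((kernelMatrix (gaussKernel b) n s - 1) *ᵥ x)| ≤ 1 / 2 * (x ⬝ᵥ x) := by
  obtain ⟨K, hK, hsum⟩ := exists_sum_exp_latticeDist_le d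
  refine ⟨(1 + |Real.log (2 * K)|) / ρ ^ 2, by positivity, ?_⟩
  intro b hb n w s hs x
  rw [ge_iff_le, div_le_iff₀ (by positivity)] at hb
  have hb1 : 1 ≤ b * ρ ^ 2 := by linarith [abs_nonneg (Real.log (2 * K))]
  have hbK : Real.exp (1 - b * ρ ^ 2) * K ≤ 1 / 2 := by
    have h1 : Real.exp (1 - b * ρ ^ 2) ≤ Real.exp (-Real.log (2 * K)) :=
      Real.exp_le_exp.2 (by linarith [le_abs_self (Real.log (2 * K))])
    rw [Real.exp_neg, Real.exp_log (by positivity)] at h1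
    calc _ ≤ (2 * K)⁻¹ * K := by gcongr
      _ = 1 / 2 := by field_simp
  refine abs_dotProduct_mulVec_le (W := fun i j =>
    Real.exp (1 - b * ρ ^ 2) * Real.exp (-latticeDist (w i) (w j))) ?_ ?_ ?_ x
  · intro i j
    by_cases hij : i = j
    · subst hij
      simp only [Matrix.sub_apply, kernelMatrix, Matrix.of_apply, gaussKernel, Matrix.one_apply_eq]
      simp
      positivity
    · rw [Matrix.sub_apply, Matrix.one_apply_ne hij, sub_zero]
      simp only [kernelMatrix, Matrix.of_apply, gaussKernel]
      rw [abs_of_pos (Real.exp_pos _), ← Real.exp_add, Real.exp_le_exp]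
      have hw : w i ≠ w j := fun h => hij (hs.injective_fin n h)
      have hint : ∀ k, |(w i k - w j k : ℝ)| ≤ |(w i k - w j k : ℝ)| ^ 2 := fun k => by
        have h2 : |w i k - w j k| ≤ |w i k - w j k| ^ 2 := by
          rcases (abs_nonneg (w i k - w j k)).eq_or_lt with h | h
          · rw [← h]; norm_num
          · nlinarith
        exact_mod_cast h2
      have hD : 1 ≤ latticeDist (w i) (w j) := by
        obtain ⟨k, hk⟩ := Function.ne_iff.1 hw
        have h3 : (1 : ℝ) ≤ |(w i k - w j k : ℝ)| := by
          exact_mod_cast Int.one_le_abs (sub_ne_zero.2 hk)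
        exact h3.trans (Finset.single_le_sum (f := fun k => |(w i k - w j k : ℝ)|)
          (fun _ _ => abs_nonneg _) (Finset.mem_univ k))
      have hnorm : ρ ^ 2 * latticeDist (w i) (w j) ≤ ‖s i - s j‖ ^ 2 := by
        rw [EuclideanSpace.norm_sq_eq, latticeDist, Finset.mul_sum]
        refine Finset.sum_le_sum fun k _ => ?_
        calc ρ ^ 2 * |(w i k - w j k : ℝ)| ≤ ρ ^ 2 * |(w i k - w j k : ℝ)| ^ 2 := by
              have := hint k; gcongr
          _ = (ρ * |(w i k - w j k : ℝ)|) ^ 2 := by ring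
          _ ≤ |s i k - s j k| ^ 2 := by have := hs.le i j k; gcongr
          _ = _ := by simp
      have hb0 : 0 ≤ b := by
        by_contra hneg
        nlinarith [mul_pos (neg_pos.2 (not_le.1 hneg)) (pow_pos hρ 2)]
      nlinarith [mul_le_mul_of_nonneg_left hnorm hb0]
  · intro i j
    simp only [latticeDist_comm]
  · intro i
    rw [← Finset.mul_sum]
    refine le_trans ?_ hbK
    have := hsum _ (hs.injective_fin n) i
    gcongr

/-! ### Lower bounds from the spectral density -/

/-- The cosine transform of a non-negative integrable function is positive semidefinite. -/
theorem dotProduct_kernelMatrix_nonneg {d n : ℕ} {φ : Eucl d → ℝ} (hφ : Integrable φ)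
    (hφ0 : ∀ f, 0 ≤ φ f) {g : Eucl d → ℝ} (hg : ∀ s, g s = ∫ f, φ f * Real.cos (inner ℝ f s))
    (s : ℕ → Eucl d) (x : Fin n → ℝ) : 0 ≤ x ⬝ᵥ (kernelMatrix g n s *ᵥ x) := by
  rw [dotProduct_kernelMatrix]
  have hint : ∀ u : Eucl d, Integrable fun f => φ f * Real.cos (inner ℝ f u) := fun u =>
    hφ.mul_bdd (c := 1) (by fun_prop) (ae_of_all _ fun f => by simpa using Real.abs_cos_le_one _)
  have h1 : ∑ i : Fin n, ∑ j : Fin n, x i * x j * g (s i - s j) =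
      ∫ f, ∑ i : Fin n, ∑ j : Fin n, x i * x j * (φ f * Real.cos (inner ℝ f (s i - s j))) := by
    rw [integral_finsetSum _ fun i _ => integrable_finsetSum _ fun j _ => (hint _).const_mul _]
    refine Finset.sum_congr rfl fun i _ => ?_
    rw [integral_finsetSum _ fun j _ => (hint _).const_mul _]
    refine Finset.sum_congr rfl fun j _ => ?_
    rw [integral_const_mul, hg]
  rw [h1]
  refine integral_nonneg fun f => ?_
  have h2 : ∑ i : Fin n, ∑ j : Fin n, x i * x j * (φ f * Real.cos (inner ℝ f (s i - s j))) =
      φ f * ((∑ i : Fin n, x i * Real.cos (inner ℝ f (s i))) ^ 2 +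
        (∑ i : Fin n, x i * Real.sin (inner ℝ f (s i))) ^ 2) := by
    rw [sq, sq, Finset.sum_mul_sum, Finset.sum_mul_sum, ← Finset.sum_add_distrib, Finset.mul_sum]
    refine Finset.sum_congr rfl fun i _ => ?_
    rw [← Finset.sum_add_distrib, Finset.mul_sum]
    refine Finset.sum_congr rfl fun j _ => ?_
    rw [inner_sub_right, Real.cos_sub]
    ring
  simp only [h2]
  exact mul_nonneg (hφ0 f) (by positivity)

/-- The Fourier integral of a real function, if real valued, is its cosine transform. -/
theorem eq_integral_cos {d : ℕ} {φ : Eucl d → ℝ} (hφ : Integrable φ) {g : Eucl d → ℝ}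
    (hg : ∀ s, (g s : ℂ) = ∫ f, (φ f : ℂ) * Complex.exp (Complex.I * (inner ℝ f s : ℝ)))
    (s : Eucl d) : g s = ∫ f, φ f * Real.cos (inner ℝ f s) := by
  have hint : Integrable fun f => (φ f : ℂ) * Complex.exp (Complex.I * (inner ℝ f s : ℝ)) := by
    refine hφ.ofReal.mul_bdd (c := 1) (by fun_prop) (ae_of_all _ fun f => ?_)
    rw [mul_comm, Complex.norm_exp_ofReal_mul_I]
  have h := congrArg Complex.re (hg s)
  rw [Complex.ofReal_re] at h
  rw [h, ← RCLike.re_eq_complex_re, ← integral_re hint]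
  refine integral_congr_ae (ae_of_all _ fun f => ?_)
  simp only [RCLike.re_eq_complex_re]
  rw [Complex.re_ofReal_mul, mul_comm Complex.I, Complex.exp_ofReal_mul_I_re]

theorem integrable_gaussKernel {d : ℕ} {a : ℝ} (ha : 0 < a) :
    Integrable (gaussKernel a : Eucl d → ℝ) := by
  have h := GaussianFourier.integrable_cexp_neg_mul_sq_norm_add (V := Eucl d) (b := (a : ℂ))
    (by simpa using ha) 0 0
  refine h.re.congr (ae_of_all _ fun f => ?_)
  simp only [gaussKernel, zero_mul, add_zero, RCLike.re_eq_complex_re]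
  rw [← Complex.exp_ofReal_re]
  push_cast
  rfl

/-- The Fourier transform of a Gaussian, in real form. -/
theorem integral_gaussKernel_mul_cos {d : ℕ} {a : ℝ} (ha : 0 < a) (s : Eucl d) :
    ∫ f, gaussKernel a f * Real.cos (inner ℝ f s) =
      (Real.pi / a) ^ ((d : ℝ) / 2) * gaussKernel (1 / (4 * a)) s := by
  symm
  refine eq_integral_cos (g := fun s => (Real.pi / a) ^ ((d : ℝ) / 2) *
    gaussKernel (1 / (4 * a)) s) (integrable_gaussKernel ha) (fun s => ?_) s
  have h := GaussianFourier.integral_cexp_neg_mul_sq_norm_add (V := Eucl d) (b := (a : ℂ))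
    (by simpa using ha) Complex.I s
  have h1 : ∀ f : Eucl d, Complex.exp (-(a : ℂ) * ‖f‖ ^ 2 + Complex.I * (inner ℝ s f : ℝ)) =
      (gaussKernel a f : ℂ) * Complex.exp (Complex.I * (inner ℝ f s : ℝ)) := fun f => by
    rw [Complex.exp_add, gaussKernel, real_inner_comm]
    push_cast
    rfl
  simp only [h1] at h
  rw [h, gaussKernel]
  push_cast
  rw [Complex.ofReal_cpow (by positivity)]
  simp
  left
  congr 1
  ring

/-- **Uniform ellipticity**: for covariance functions with a strictly positive spectral density
that is jointly continuous in the parameter, the covariance matrices of separated points are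
bounded below, uniformly in the parameter, the points and their number. The spectral density is
bounded below by a difference of two Gaussians, which is negative outside of a large ball. -/
theorem exists_lower_bound {d p : ℕ} {Θ : Set (Eucl p)} (hΘ : IsCompact Θ)
    {c : Eucl p → Eucl d → ℝ} (hc : HasPositiveSpectralDensity Θ c) {ρ : ℝ} (hρ : 0 < ρ) :
    ∃ lam : ℝ, 0 < lam ∧ ∀ θ ∈ Θ, ∀ {n : ℕ} {w : ℕ → Fin d → ℤ} {s : ℕ → Eucl d},
      IsSpread ρ w s → ∀ x : Fin n → ℝ,
      lam * (x ⬝ᵥ x) ≤ x ⬝ᵥ (kernelMatrix (c θ) n s *ᵥ x) := by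
  obtain ⟨chat, hcont, hpos, hint⟩ := hc
  obtain ⟨b, hb, hnear⟩ := exists_gaussKernel_near_one d hρ
  -- the Fourier transforms of the two Gaussians are multiples of `exp (-b |s|²)`, `exp (-2 b |s|²)`
  set a := 1 / (4 * b) with ha
  have ha0 : 0 < a := by positivity
  set γ := (Real.pi / a) ^ ((d : ℝ) / 2) with hγ
  set γ' := (Real.pi / (a / 2)) ^ ((d : ℝ) / 2) with hγ'
  have hγ0 : 0 < γ := by have := Real.pi_pos; positivity
  have hγ'0 : 0 < γ' := by have := Real.pi_pos; positivity
  -- `R` makes the weight `β = exp (-a R² / 2)` of the wider Gaussian small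
  set R := √(2 / a * |Real.log (γ / (6 * γ'))|) with hR
  set β := Real.exp (-(a / 2) * R ^ 2) with hβ
  have hβ0 : 0 < β := Real.exp_pos _
  have hβγ : β * γ' ≤ γ / 6 := by
    have h1 : β ≤ γ / (6 * γ') := by
      have h2 : 0 < γ / (6 * γ') := by positivity
      rw [hβ, hR, Real.sq_sqrt (by positivity)]
      nth_rewrite 2 [← Real.exp_log h2]
      rw [Real.exp_le_exp]
      have h3 : -(a / 2) * (2 / a * |Real.log (γ / (6 * γ'))|) = -|Real.log (γ / (6 * γ'))| := by
        field_simp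
      rw [h3]
      exact neg_abs_le _
    calc β * γ' ≤ γ / (6 * γ') * γ' := by gcongr
      _ = γ / 6 := by field_simp
  obtain ⟨m, hm0, hm⟩ := (hΘ.prod (isCompact_closedBall (0 : Eucl d) R)).exists_forall_le'
    (hcont.mono (Set.prod_mono_right (Set.subset_univ _))) (a := 0)
    (fun q hq => hpos q.1 hq.1 q.2)
  refine ⟨m * γ / 4, by positivity, fun θ hθ n w s hs x => ?_⟩
  obtain ⟨hcint, hcF⟩ := hint θ hθ
  set φ : Eucl d → ℝ := fun f => chat θ f - m * (gaussKernel a f - β * gaussKernel (a / 2) f)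
  have hga := integrable_gaussKernel (d := d) ha0
  have hga2 := integrable_gaussKernel (d := d) (half_pos ha0)
  have hφint : Integrable φ := hcint.sub ((hga.sub (hga2.const_mul β)).const_mul m)
  have hφ0 : ∀ f, 0 ≤ φ f := by
    intro f
    have hsq : gaussKernel a f = gaussKernel (a / 2) f * gaussKernel (a / 2) f := by
      rw [gaussKernel, gaussKernel, ← Real.exp_add]
      congr 1
      ring
    have hg2 : 0 < gaussKernel (a / 2) f := Real.exp_pos _
    rcases le_or_gt ‖f‖ R with hf | hf
    · have h1 : m ≤ chat θ f := hm (θ, f) ⟨hθ, by simpa using hf⟩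
      have h2 : gaussKernel a f ≤ 1 := Real.exp_le_one_iff.2 (by nlinarith [sq_nonneg ‖f‖])
      have h3 : gaussKernel a f - β * gaussKernel (a / 2) f ≤ 1 := by
        linarith [mul_pos hβ0 hg2]
      simp only [φ]
      nlinarith
    · have h1 : gaussKernel (a / 2) f ≤ β := by
        rw [gaussKernel, hβ, Real.exp_le_exp]
        have : R ^ 2 ≤ ‖f‖ ^ 2 := by
          have : 0 ≤ R := Real.sqrt_nonneg _
          gcongr
        nlinarith
      have h3 : gaussKernel a f - β * gaussKernel (a / 2) f ≤ 0 := by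
        rw [hsq]; nlinarith
      simp only [φ]
      nlinarith [hpos θ hθ f]
  have hcos : ∀ {ψ : Eucl d → ℝ}, Integrable ψ → ∀ u : Eucl d,
      Integrable fun f => ψ f * Real.cos (inner ℝ f u) := fun hψ u =>
    hψ.mul_bdd (c := 1) (by fun_prop) (ae_of_all _ fun f => by simpa using Real.abs_cos_le_one _)
  have hk := dotProduct_kernelMatrix_nonneg (n := n) hφint hφ0 (g := fun u => c θ u -
    m * (γ * gaussKernel b u - β * (γ' * gaussKernel (2 * b) u))) (fun u => by
      have e1 : ∀ f, φ f * Real.cos (inner ℝ f u) = chat θ f * Real.cos (inner ℝ f u) -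
          m * (gaussKernel a f * Real.cos (inner ℝ f u) -
            β * (gaussKernel (a / 2) f * Real.cos (inner ℝ f u))) := fun f => by
        simp only [φ]; ring
      have e0 : Integrable fun f => m * (gaussKernel a f * Real.cos (inner ℝ f u) -
          β * (gaussKernel (a / 2) f * Real.cos (inner ℝ f u))) :=
        ((hcos hga u).sub ((hcos hga2 u).const_mul β)).const_mul m
      simp only [e1]
      rw [integral_sub (hcos hcint u) e0,
        integral_const_mul, integral_sub (hcos hga u) ((hcos hga2 u).const_mul β),
        integral_const_mul, integral_gaussKernel_mul_cos ha0,
        integral_gaussKernel_mul_cos (half_pos ha0), ← eq_integral_cos hcint hcF u]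
      have e2 : 1 / (4 * a) = b := by rw [ha]; field_simp
      have e3 : 1 / (4 * (a / 2)) = 2 * b := by rw [ha]; field_simp
      rw [e2, e3]) s x
  have h1 := hnear b le_rfl (n := n) hs x
  have h2 := hnear (2 * b) (by linarith) (n := n) hs x
  rw [Matrix.sub_mulVec, dotProduct_sub, Matrix.one_mulVec] at h1 h2
  have h3 : x ⬝ᵥ (kernelMatrix (fun u => c θ u -
      m * (γ * gaussKernel b u - β * (γ' * gaussKernel (2 * b) u))) n s *ᵥ x) =
      x ⬝ᵥ (kernelMatrix (c θ) n s *ᵥ x) -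
        m * (γ * (x ⬝ᵥ (kernelMatrix (gaussKernel b) n s *ᵥ x)) -
          β * (γ' * (x ⬝ᵥ (kernelMatrix (gaussKernel (2 * b)) n s *ᵥ x)))) := by
    simp only [dotProduct_kernelMatrix, Finset.mul_sum, ← Finset.sum_sub_distrib]
    exact Finset.sum_congr rfl fun i _ => Finset.sum_congr rfl fun j _ => by ring
  rw [h3] at hk
  have h4 := (abs_le.1 h1).1
  have h5 := (abs_le.1 h2).2
  have hx0 : 0 ≤ x ⬝ᵥ x := by
    simpa [dotProduct] using Finset.sum_nonneg fun i _ => mul_self_nonneg (x i)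
  set X := x ⬝ᵥ x
  set G1 := x ⬝ᵥ (kernelMatrix (gaussKernel b) n s *ᵥ x)
  set G2 := x ⬝ᵥ (kernelMatrix (gaussKernel (2 * b)) n s *ᵥ x)
  have h6 : γ * (1 / 2 * X) ≤ γ * G1 := by
    have : 1 / 2 * X ≤ G1 := by linarith
    gcongr
  have h7 : β * (γ' * G2) ≤ γ / 4 * X := by
    calc β * (γ' * G2) ≤ β * (γ' * (3 / 2 * X)) := by
          have : G2 ≤ 3 / 2 * X := by linarith
          gcongr
      _ = (β * γ') * (3 / 2 * X) := by ring
      _ ≤ γ / 6 * (3 / 2 * X) := by gcongr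
      _ = _ := by ring
  have h8 : m * (γ / 4 * X) ≤ m * (γ * G1 - β * (γ' * G2)) := by
    have : γ / 4 * X ≤ γ * G1 - β * (γ' * G2) := by linarith
    gcongr
  calc m * γ / 4 * X = m * (γ / 4 * X) := by ring
    _ ≤ _ := h8
    _ ≤ _ := by linarith

/-! ### Differences of sites of the perturbed grid -/

/-- The point with index `i` of the grid perturbed by the deterministic displacements `x`. -/
noncomputable def gridSite {d : ℕ} (τ : ℝ) (v : ℕ → Fin d → ℕ) (x : ℕ → Eucl d) (i : ℕ) : Eucl d :=
  intPoint (fun k => (v i k : ℤ)) + τ • x i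

theorem IsGridEnumeration.exists_index {d : ℕ} {v : ℕ → Fin d → ℕ} (hv : IsGridEnumeration v)
    {I : ℕ} {w : Fin d → ℕ} (hw : ∀ k, 1 ≤ w k ∧ w k ≤ I) (hI : 1 ≤ I) :
    ∃ i < I ^ d, v i = w := by
  have h : w ∈ v '' Set.Iio (I ^ d) := by rw [hv I hI]; exact hw
  obtain ⟨i, hi, rfl⟩ := h
  exact ⟨i, hi, rfl⟩

theorem IsGridEnumeration.injective {d : ℕ} (hd : 1 ≤ d) {v : ℕ → Fin d → ℕ}
    (hv : IsGridEnumeration v) : Function.Injective v := by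
  intro i j hij
  set I := i + j + 1 with hI
  have himg : (Finset.range (I ^ d)).image v = Fintype.piFinset fun _ => Finset.Icc 1 I := by
    ext w
    have h := Set.ext_iff.1 (hv I (by omega)) w
    simp only [Set.mem_image, Set.mem_Iio, Set.mem_ofPred_eq] at h
    simp only [Finset.mem_image, Finset.mem_range, Fintype.mem_piFinset, Finset.mem_Icc]
    exact h
  have hinj : Set.InjOn v (Finset.range (I ^ d)) := Finset.card_image_iff.1 (by rw [himg]; simp)
  have hle : I ≤ I ^ d := Nat.le_self_pow (by omega) I
  exact hinj (by simp; omega) (by simp; omega) hij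

theorem isSpread_gridSite {d : ℕ} (hd : 1 ≤ d) {τ : ℝ} (hτ : 0 ≤ τ) {v : ℕ → Fin d → ℕ}
    (hv : IsGridEnumeration v) {x : ℕ → Eucl d} (hx : ∀ i, x i ∈ cube d) :
    IsSpread (1 - 2 * τ) (fun i k => (v i k : ℤ)) (gridSite τ v x) := by
  refine ⟨fun i j hij => hv.injective hd (funext fun k => ?_), fun i j k => ?_⟩
  · exact_mod_cast congrFun hij k
  · have hi := hx i k
    have hj := hx j k
    have he : gridSite τ v x i k - gridSite τ v x j k =
        ((v i k : ℤ) - (v j k : ℤ) : ℝ) + τ * (x i k - x j k) := by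
      simp [gridSite, intPoint]; ring
    rw [he]
    have hd2 : |τ * (x i k - x j k)| ≤ 2 * τ := by
      rw [abs_mul, abs_of_nonneg hτ, mul_comm]
      refine mul_le_mul_of_nonneg_right ?_ hτ
      rw [abs_le]
      constructor <;> linarith [hi.1, hi.2, hj.1, hj.2]
    set D : ℝ := ((v i k : ℤ) - (v j k : ℤ) : ℝ) with hD
    have h1 : |D| - |τ * (x i k - x j k)| ≤ |D + τ * (x i k - x j k)| := by
      have := abs_sub_abs_le_abs_sub D (-(τ * (x i k - x j k)))
      rwa [abs_neg, sub_neg_eq_add] at this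
    by_cases h0 : (v i k : ℤ) = v j k
    · have : D = 0 := by rw [hD, h0, sub_self]
      rw [this]
      simp
      positivity
    · have h2 : 1 ≤ |D| := by
        rw [hD]
        exact_mod_cast Int.one_le_abs (sub_ne_zero.2 h0)
      nlinarith

/-- For a nonzero integer vector `z`, a positive fraction of the first `n` grid points can be
arranged into disjoint pairs of points with difference `z`: the base points are the points all
coordinates of which are multiples of a large number. -/
theorem exists_disjoint_pairs {d : ℕ} (hd : 1 ≤ d) {v : ℕ → Fin d → ℕ} (hv : IsGridEnumeration v)
    {z : Fin d → ℤ} (hz : z ≠ 0) : ∃ κ : ℝ, 0 < κ ∧ ∀ᶠ n : ℕ in atTop,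
      ∃ (U : Finset (Fin d → ℕ)) (a b : (Fin d → ℕ) → ℕ), κ * n ≤ U.card ∧
        (∀ u ∈ U, a u < n ∧ b u < n ∧ ∀ k, (v (b u) k : ℤ) - v (a u) k = z k) ∧
        ∀ u ∈ U, ∀ u' ∈ U, a u ≠ b u' ∧ (u ≠ u' → a u ≠ a u' ∧ b u ≠ b u') := by
  obtain ⟨M, hM, hzM⟩ : ∃ M : ℕ, 1 ≤ M ∧ ∀ k, |z k| < M := by
    refine ⟨1 + ∑ k, (z k).natAbs, by omega, fun k => ?_⟩
    have := Finset.single_le_sum (f := fun k => (z k).natAbs) (fun _ _ => Nat.zero_le _)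
      (Finset.mem_univ k)
    rw [Int.abs_eq_natAbs]
    have h : (z k).natAbs ≤ ∑ k, (z k).natAbs := this
    omega
  refine ⟨1 / (3 * M) ^ d, by positivity, ?_⟩
  filter_upwards [eventually_ge_atTop ((M * 2) ^ d)] with n hn
  have hex : ∃ t, n < (M * (t + 1)) ^ d := by
    refine ⟨n, ?_⟩
    calc n < M * (n + 1) := by nlinarith
      _ ≤ _ := Nat.le_self_pow (by omega) _
  classical
  obtain ⟨t, ht, htmin⟩ : ∃ t, n < (M * (t + 1)) ^ d ∧ ∀ t' < t, (M * (t' + 1)) ^ d ≤ n :=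
    ⟨Nat.find hex, Nat.find_spec hex, fun t' ht' => not_lt.1 (Nat.find_min hex ht')⟩
  have ht2 : 2 ≤ t := by
    by_contra hlt
    have : (M * (t + 1)) ^ d ≤ (M * 2) ^ d := by
      gcongr
      omega
    omega
  obtain ⟨m, rfl⟩ : ∃ m, t = m + 1 := ⟨t - 1, by omega⟩
  have hIn : (M * (m + 1)) ^ d ≤ n := htmin m (by omega)
  have hidx : ∀ w : Fin d → ℕ, (∀ k, 1 ≤ w k ∧ w k ≤ M * (m + 1)) →
      ∃ i < (M * (m + 1)) ^ d, v i = w := fun w hw =>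
    hv.exists_index hw (Nat.mul_pos (by omega) (by omega))
  choose! idx hlt hidxv using hidx
  set A : (Fin d → ℕ) → Fin d → ℕ := fun u k => M * u k
  set B : (Fin d → ℕ) → Fin d → ℕ := fun u k => (M * u k + z k).toNat
  set U : Finset (Fin d → ℕ) := Fintype.piFinset fun _ => Finset.Icc 1 m
  have hU : ∀ u ∈ U, ∀ k, 1 ≤ u k ∧ u k ≤ m := fun u hu k => by
    simpa using Fintype.mem_piFinset.1 hu k
  have hA : ∀ u ∈ U, ∀ k, 1 ≤ A u k ∧ A u k ≤ M * (m + 1) := fun u hu k => by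
    have := hU u hu k
    simp only [A]
    constructor <;> nlinarith
  have hBz : ∀ u ∈ U, ∀ k, (B u k : ℤ) = M * u k + z k := fun u hu k => by
    have h1 := (hU u hu k).1
    have h2 := abs_lt.1 (hzM k)
    have h3 : (1 : ℤ) ≤ u k := by exact_mod_cast h1
    simp only [B]
    rw [Int.toNat_of_nonneg]
    nlinarith
  have hB : ∀ u ∈ U, ∀ k, 1 ≤ B u k ∧ B u k ≤ M * (m + 1) := fun u hu k => by
    have h2 := abs_lt.1 (hzM k)
    have h3 : (1 : ℤ) ≤ u k := by exact_mod_cast (hU u hu k).1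
    have h4 : (u k : ℤ) ≤ m := by exact_mod_cast (hU u hu k).2
    have h5 := hBz u hu k
    have h6 : (1 : ℤ) ≤ M := by exact_mod_cast hM
    have h7 : (1 : ℤ) ≤ B u k := by rw [h5]; nlinarith
    have h8 : (B u k : ℤ) ≤ M * (m + 1) := by rw [h5]; nlinarith
    exact ⟨by exact_mod_cast h7, by exact_mod_cast h8⟩
  refine ⟨U, fun u => idx (A u), fun u => idx (B u), ?_, ?_, ?_⟩
  · have hcard : (U.card : ℝ) = (m : ℝ) ^ d := by simp [U]
    rw [hcard, one_div, inv_mul_le_iff₀ (by positivity)]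
    have h1 : n ≤ (3 * M * m) ^ d := by
      refine ht.le.trans ?_
      refine Nat.pow_le_pow_left ?_ d
      calc M * (m + 1 + 1) ≤ M * (3 * m) := Nat.mul_le_mul_left M (by omega)
        _ = 3 * M * m := by ring
    have h2 : (n : ℝ) ≤ ((3 * M * m : ℕ) : ℝ) ^ d := by exact_mod_cast h1
    refine h2.trans (le_of_eq ?_)
    push_cast
    rw [mul_pow]
  · intro u hu
    refine ⟨(hlt _ (hA u hu)).trans_le hIn, (hlt _ (hB u hu)).trans_le hIn, fun k => ?_⟩
    simp only
    rw [hidxv _ (hA u hu), hidxv _ (hB u hu), hBz u hu k]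
    simp [A]
  · intro u hu u' hu'
    refine ⟨fun h => ?_, fun hne => ⟨fun h => hne ?_, fun h => hne ?_⟩⟩
    · have h1 := congrArg v h
      simp only at h1
      rw [hidxv _ (hA u hu), hidxv _ (hB u' hu')] at h1
      refine hz (funext fun k => ?_)
      have h2 : (A u k : ℤ) = B u' k := by rw [h1]
      rw [hBz u' hu' k] at h2
      simp only [A] at h2
      push_cast at h2
      refine Int.eq_zero_of_abs_lt_dvd (m := M) ⟨(u k : ℤ) - u' k, ?_⟩ (hzM k)
      linarith
    · have h1 := congrArg v h
      simp only at h1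
      rw [hidxv _ (hA u hu), hidxv _ (hA u' hu')] at h1
      funext k
      exact Nat.eq_of_mul_eq_mul_left (by omega) (congrFun h1 k)
    · have h1 := congrArg v h
      simp only at h1
      rw [hidxv _ (hB u hu), hidxv _ (hB u' hu')] at h1
      funext k
      have h2 : (B u k : ℤ) = B u' k := by rw [h1]
      rw [hBz u hu k, hBz u' hu' k] at h2
      have h3 : (M : ℤ) * u k = M * u' k := by linarith
      exact Nat.eq_of_mul_eq_mul_left (show 0 < M by omega) (by exact_mod_cast h3)

/-- A common law with a density that is positive on the cube charges the neighbourhoods of all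
points of the cube. -/
theorem IsPerturbation.exists_pos_measure_ball {Ω : Type*} [MeasurableSpace Ω] {P : Measure Ω}
    [IsProbabilityMeasure P] {d : ℕ} {X : ℕ → Ω → Eucl d} (hX : IsPerturbation P X) {u : Eucl d}
    (hu : u ∈ cube d) {r : ℝ} (hr : 0 < r) :
    ∃ q : ℝ, 0 < q ∧ ∀ i, P.real (X i ⁻¹' Metric.ball u r) = q := by
  obtain ⟨f, hf, hfpos, hlaw⟩ := hX.density
  have hmap : ∀ i, P.real (X i ⁻¹' Metric.ball u r) =
      ((volume.restrict (cube d)).withDensity f).real (Metric.ball u r) := fun i => by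
    rw [← hlaw i, map_measureReal_apply (hX.measurable i) measurableSet_ball]
  refine ⟨_, ?_, hmap⟩
  have hprob : IsProbabilityMeasure ((volume.restrict (cube d)).withDensity f) := by
    rw [← hlaw 0]
    exact Measure.isProbabilityMeasure_map (hX.measurable 0).aemeasurable
  refine ENNReal.toReal_pos ?_ (measure_ne_top _ _)
  have hcube : MeasurableSet (cube d) := by
    have : cube d = ⋂ k, (fun x : Eucl d => x k) ⁻¹' Set.Icc (-1) 1 := by
      ext x; simp [cube]
    rw [this]
    exact MeasurableSet.iInter fun k => measurableSet_Icc.preimage (by fun_prop)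
  rw [withDensity_apply _ measurableSet_ball, Measure.restrict_restrict measurableSet_ball]
  intro h0
  rw [lintegral_eq_zero_iff hf] at h0
  -- the open set of interior points of the cube in the ball has positive volume
  set V : Set (Eucl d) := Metric.ball u r ∩ {x | ∀ k, x k ∈ Set.Ioo (-1 : ℝ) 1}
  have hVopen : IsOpen V := by
    refine Metric.isOpen_ball.inter ?_
    have : {x : Eucl d | ∀ k, x k ∈ Set.Ioo (-1 : ℝ) 1} =
        ⋂ k, (fun x : Eucl d => x k) ⁻¹' Set.Ioo (-1) 1 := by
      ext x; simp
    rw [this]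
    exact isOpen_iInter_of_finite fun k => isOpen_Ioo.preimage (by fun_prop)
  have hVne : V.Nonempty := by
    have hcont : Tendsto (fun t : ℝ => (1 - t) • u) (𝓝[>] 0) (𝓝 u) := by
      have h1 : ContinuousAt (fun t : ℝ => (1 - t) • u) 0 := by fun_prop
      have h2 := h1.tendsto
      simp only [sub_zero, one_smul] at h2
      exact h2.mono_left nhdsWithin_le_nhds
    have h3 : ∀ᶠ t : ℝ in 𝓝[>] 0, t ∈ Set.Ioo (0 : ℝ) 1 :=
      Ioo_mem_nhdsGT one_pos
    obtain ⟨t, ht1, ht2⟩ := ((hcont.eventually (Metric.ball_mem_nhds u hr)).and h3).exists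
    refine ⟨(1 - t) • u, ht1, fun k => ?_⟩
    have hk := hu k
    simp only [PiLp.smul_apply, smul_eq_mul]
    constructor <;> nlinarith [hk.1, hk.2, ht2.1, ht2.2]
  have hVpos := hVopen.measure_pos volume hVne
  have hsub : V ⊆ Metric.ball u r ∩ cube d :=
    Set.inter_subset_inter_right _ fun x hx k => Set.Ioo_subset_Icc_self (hx k)
  have h4 : ∀ᵐ x ∂(volume.restrict (Metric.ball u r ∩ cube d)), False := by
    filter_upwards [h0, ae_restrict_mem (measurableSet_ball.inter hcube)] with x hx1 hx2
    exact (hfpos x hx2.2).ne' hx1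
  have h5 : volume (Metric.ball u r ∩ cube d) = 0 := by
    simpa using h4
  exact hVpos.ne' (measure_mono_null hsub h5)

/-- If `g ≥ 0` is continuous, and positive at the origin or at some point `z + τ (u₁ - u₂)` that
two different sites can have as their difference, then the sum of `g` over all pairs of the first
`n` sites grows at least linearly, with high probability. -/
theorem exists_sum_sites_lower_bound {Ω : Type*} [MeasurableSpace Ω] {P : Measure Ω}
    [IsProbabilityMeasure P] {d : ℕ} (hd : 1 ≤ d) (τ : ℝ) {v : ℕ → Fin d → ℕ}
    (hv : IsGridEnumeration v) {X : ℕ → Ω → Eucl d} (hX : IsPerturbation P X)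
    {g : Eucl d → ℝ} (hg : Continuous g) (hg0 : ∀ s, 0 ≤ g s)
    (hpos : 0 < g 0 ∨ ∃ z : Fin d → ℤ, z ≠ 0 ∧ ∃ u₁ ∈ cube d, ∃ u₂ ∈ cube d,
      0 < g (intPoint z + τ • (u₁ - u₂))) :
    ∃ δ > 0, Tendsto (fun n : ℕ => P {ω | ∑ i : Fin n, ∑ j : Fin n,
      g (site τ v X i ω - site τ v X j ω) < n * δ}) atTop (𝓝 0) := by
  rcases hpos with h0 | ⟨z, hz, u₁, hu₁, u₂, hu₂, hgz⟩
  · -- the diagonal terms suffice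
    refine ⟨g 0, h0, tendsto_const_nhds.congr fun n => ?_⟩
    symm
    convert measure_empty (μ := P)
    refine Set.eq_empty_of_forall_notMem fun ω hω => ?_
    simp only [Set.mem_ofPred_eq] at hω
    refine absurd hω (not_lt.2 ?_)
    calc (n : ℝ) * g 0 = ∑ i : Fin n, g (site τ v X i ω - site τ v X i ω) := by simp
      _ ≤ _ := Finset.sum_le_sum fun i _ => Finset.single_le_sum
        (f := fun j : Fin n => g (site τ v X i ω - site τ v X j ω)) (fun _ _ => hg0 _)
        (Finset.mem_univ i)
  set η := g (intPoint z + τ • (u₁ - u₂)) / 2 with hη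
  have hη0 : 0 < η := half_pos hgz
  obtain ⟨r, hr, hball⟩ : ∃ r > 0, ∀ x ∈ Metric.ball u₁ r, ∀ y ∈ Metric.ball u₂ r,
      η ≤ g (intPoint z + τ • (x - y)) := by
    have hc : Continuous fun q : Eucl d × Eucl d => g (intPoint z + τ • (q.1 - q.2)) := by fun_prop
    have hev : ∀ᶠ q in 𝓝 (u₁, u₂), η < g (intPoint z + τ • (q.1 - q.2)) :=
      hc.continuousAt.eventually (lt_mem_nhds (by rw [hη]; simpa using half_lt_self hgz))
    obtain ⟨r, hr, hsub⟩ := Metric.eventually_nhds_iff_ball.1 hev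
    refine ⟨r, hr, fun x hx y hy => (hsub (x, y) ?_).le⟩
    rw [← ball_prod_same]
    exact ⟨hx, hy⟩
  obtain ⟨q₁, hq₁, hX₁⟩ := hX.exists_pos_measure_ball hu₁ hr
  obtain ⟨q₂, hq₂, hX₂⟩ := hX.exists_pos_measure_ball hu₂ hr
  obtain ⟨κ, hκ, hpairs⟩ := exists_disjoint_pairs hd hv hz
  set q := q₁ * q₂ with hq
  have hq0 : 0 < q := mul_pos hq₁ hq₂
  refine ⟨η * (q * κ / 2), by positivity, ?_⟩
  have hlim : Tendsto (fun n : ℕ => ENNReal.ofReal (4 / (q ^ 2 * κ) / n)) atTop (𝓝 0) := by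
    rw [← ENNReal.ofReal_zero]
    exact ENNReal.tendsto_ofReal (tendsto_const_div_atTop_nhds_zero_nat _)
  refine tendsto_of_tendsto_of_tendsto_of_le_of_le' tendsto_const_nhds hlim
    (Eventually.of_forall fun _ => zero_le) ?_
  filter_upwards [hpairs, eventually_gt_atTop 0] with n hn hn0
  obtain ⟨U, a, b, hcard, hab, hdisj⟩ := hn
  have hn' : (0 : ℝ) < n := by exact_mod_cast hn0
  have hU0 : (0 : ℝ) < U.card := lt_of_lt_of_le (by positivity) hcard
  set S : Set (Eucl d × Eucl d) := Metric.ball u₁ r ×ˢ Metric.ball u₂ r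
  have hS : MeasurableSet S := measurableSet_ball.prod measurableSet_ball
  -- the indicator of the event that the displacements of a pair are close to `u₁` and `u₂`
  set Y : (Fin d → ℕ) → Ω → ℝ := fun u ω => S.indicator 1 (X (b u) ω, X (a u) ω) with hY
  have hYmeas : ∀ u, Measurable (Y u) := fun u =>
    (measurable_one.indicator hS).comp ((hX.measurable _).prodMk (hX.measurable _))
  have hY01 : ∀ u ω, Y u ω ∈ Set.Icc (0 : ℝ) 1 := fun u ω => by
    classical
    simp only [hY, Set.indicator_apply]
    split_ifs <;> simp
  have hYL2 : ∀ u, MemLp (Y u) 2 P := fun u =>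
    MemLp.of_bound (hYmeas u).aestronglyMeasurable 1 (ae_of_all _ fun ω => by
      rw [Real.norm_eq_abs, abs_of_nonneg (hY01 u ω).1]
      exact (hY01 u ω).2)
  have hYint : ∀ u ∈ U, ∫ ω, Y u ω ∂P = q := by
    intro u hu
    have hne : b u ≠ a u := ((hdisj u hu u hu).1).symm
    have h1 : Y u = (X (b u) ⁻¹' Metric.ball u₁ r ∩ X (a u) ⁻¹' Metric.ball u₂ r).indicator 1 := by
      classical
      ext ω
      simp only [hY, Set.indicator_apply, S, Set.mem_prod, Set.mem_inter_iff, Set.mem_preimage,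
        Pi.one_apply]
    rw [h1, integral_indicator_one (((hX.measurable _) measurableSet_ball).inter
      ((hX.measurable _) measurableSet_ball)), measureReal_def,
      (hX.indep.indepFun hne).measure_inter_preimage_eq_mul _ _ measurableSet_ball
        measurableSet_ball, ENNReal.toReal_mul, ← measureReal_def, ← measureReal_def, hX₁, hX₂]
  have hYvar : ∀ u, Var[Y u; P] ≤ 1 := by
    intro u
    refine (variance_le_sub_mul_sub (ae_of_all _ (hY01 u)) (hYmeas u).aemeasurable).trans ?_
    have h1 : 0 ≤ ∫ ω, Y u ω ∂P := integral_nonneg fun ω => (hY01 u ω).1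
    nlinarith [sq_nonneg (1 - ∫ ω, Y u ω ∂P)]
  have hvar : Var[∑ u ∈ U, Y u; P] ≤ U.card := by
    rw [IndepFun.variance_sum fun u _ => hYL2 u]
    · calc ∑ u ∈ U, Var[Y u; P] ≤ ∑ _u ∈ U, (1 : ℝ) := Finset.sum_le_sum fun u _ => hYvar u
        _ = U.card := by simp
    · intro u hu u' hu' hne
      have h1 := (hdisj u hu u' hu').2 hne
      have h2 : IndepFun (fun ω => (X (b u) ω, X (a u) ω)) (fun ω => (X (b u') ω, X (a u') ω)) P :=
        hX.indep.indepFun_prodMk_prodMk hX.measurable _ _ _ _ h1.2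
          ((hdisj u' hu' u hu).1).symm (hdisj u hu u' hu').1 h1.1
      exact h2.comp (measurable_one.indicator hS) (measurable_one.indicator hS)
  have hmean : ∫ ω, (∑ u ∈ U, Y u) ω ∂P = U.card * q := by
    simp only [Finset.sum_apply]
    rw [integral_finsetSum _ fun u _ => (hYL2 u).integrable (by norm_num),
      Finset.sum_congr rfl hYint]
    simp
  have ht : 0 < U.card * q / 2 := by positivity
  have hcheb := meas_ge_le_variance_div_sq (memLp_finsetSum' U fun u _ => hYL2 u) ht
  rw [hmean] at hcheb
  refine (measure_mono fun ω hω => ?_).trans (hcheb.trans (ENNReal.ofReal_le_ofReal ?_))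
  · simp only [Set.mem_ofPred_eq] at hω ⊢
    refine le_trans ?_ (neg_le_abs _)
    have h1 : η * (∑ u ∈ U, Y u) ω ≤
        ∑ i : Fin n, ∑ j : Fin n, g (site τ v X i ω - site τ v X j ω) := by
      rw [Finset.sum_apply, Finset.mul_sum]
      calc ∑ u ∈ U, η * Y u ω
          ≤ ∑ u ∈ U, g (site τ v X (b u) ω - site τ v X (a u) ω) := by
            refine Finset.sum_le_sum fun u hu => ?_
            have he : site τ v X (b u) ω - site τ v X (a u) ω =
                intPoint z + τ • (X (b u) ω - X (a u) ω) := by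
              have h2 := (hab u hu).2.2
              ext k
              have h3 : ((v (b u) k : ℝ) - v (a u) k) = z k := by exact_mod_cast h2 k
              simp [site, intPoint, ← h3]
              ring
            rw [he]
            by_cases hmem : (X (b u) ω, X (a u) ω) ∈ S
            · simp only [hY, Set.indicator_of_mem hmem, Pi.one_apply, mul_one]
              exact hball _ hmem.1 _ hmem.2
            · simp only [hY, Set.indicator_of_notMem hmem, mul_zero]
              exact hg0 _
        _ = ∑ e ∈ U.image fun u => (b u, a u), g (site τ v X e.1 ω - site τ v X e.2 ω) := by
            rw [Finset.sum_image]
            intro u hu u' hu' hbu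
            by_contra hne
            exact ((hdisj u hu u' hu').2 hne).2 (Prod.ext_iff.1 hbu).1
        _ ≤ ∑ e ∈ Finset.range n ×ˢ Finset.range n,
              g (site τ v X e.1 ω - site τ v X e.2 ω) := by
            refine Finset.sum_le_sum_of_subset_of_nonneg (fun e he => ?_) fun _ _ _ => hg0 _
            obtain ⟨u, hu, rfl⟩ := Finset.mem_image.1 he
            simp [(hab u hu).1, (hab u hu).2.1]
        _ = _ := by
            rw [Finset.sum_product, Finset.sum_range]
            exact Finset.sum_congr rfl fun i _ => Finset.sum_range _
    have h2 : n * (η * (q * κ / 2)) ≤ η * (U.card * q / 2) := by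
      calc n * (η * (q * κ / 2)) = η * ((κ * n) * q / 2) := by ring
        _ ≤ _ := by gcongr
    have h3 : η * (∑ u ∈ U, Y u) ω < η * (U.card * q / 2) := lt_of_le_of_lt h1 (hω.trans_le h2)
    have h4 := lt_of_mul_lt_mul_left h3 hη0.le
    linarith
  · calc Var[∑ u ∈ U, Y u; P] / (U.card * q / 2) ^ 2 ≤ U.card / (U.card * q / 2) ^ 2 := by gcongr
      _ = 4 / (q ^ 2 * U.card) := by field_simp; norm_num
      _ ≤ 4 / (q ^ 2 * (κ * n)) := by gcongr
      _ = _ := by field_simp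

/-! ### Conditioning on the sites -/

/-- If every section of an event in the independent pair `(X, Y)` at a value of `X` has probability
at most `b`, then so has the event. -/
theorem measure_le_of_forall_section {Ω E F : Type*} [MeasurableSpace Ω] [MeasurableSpace E]
    [MeasurableSpace F] {P : Measure Ω} [IsProbabilityMeasure P] {X : Ω → E} {Y : Ω → F}
    (hX : Measurable X) (hY : Measurable Y) (hXY : IndepFun X Y P) {G : Set (E × F)}
    (hG : MeasurableSet G) {b : ENNReal} (hb : ∀ x, P {ω | (x, Y ω) ∈ G} ≤ b) :
    P {ω | (X ω, Y ω) ∈ G} ≤ b := by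
  have hPX : IsProbabilityMeasure (P.map X) := Measure.isProbabilityMeasure_map hX.aemeasurable
  have hPY : IsProbabilityMeasure (P.map Y) := Measure.isProbabilityMeasure_map hY.aemeasurable
  have h1 : P {ω | (X ω, Y ω) ∈ G} = (P.map fun ω => (X ω, Y ω)) G := by
    rw [Measure.map_apply (hX.prodMk hY) hG]
    rfl
  rw [h1, (indepFun_iff_map_prod_eq_prod_map_map hX.aemeasurable hY.aemeasurable).1 hXY,
    Measure.prod_apply hG]
  calc ∫⁻ x, (P.map Y) (Prod.mk x ⁻¹' G) ∂(P.map X) ≤ ∫⁻ _x, b ∂(P.map X) := by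
        refine lintegral_mono fun x => ?_
        rw [Measure.map_apply hY (measurable_prodMk_left hG)]
        exact hb x
    _ = b := by simp

/-- `IsFieldIndepOf.measure_le` for a field that is a measurable function of a random element `Y`
independent of the displacements. -/
theorem measure_field_le_of_indepFun {Ω F : Type*} [MeasurableSpace Ω] [MeasurableSpace F]
    {P : Measure Ω} [IsProbabilityMeasure P] {d : ℕ} {X : ℕ → Ω → Eucl d}
    (hX : ∀ i, Measurable (X i)) {Y : Ω → F} (hY : Measurable Y)
    (hXY : IndepFun (fun ω i => X i ω) Y P) {W : Eucl d → F → ℝ}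
    (hW : Measurable fun q : Eucl d × F => W q.1 q.2)
    {s : (ℕ → Eucl d) → ℕ → Eucl d} (hs : ∀ i, Measurable fun x => s x i)
    {G : Set ((ℕ → Eucl d) × (ℕ → ℝ))} (hG : MeasurableSet G) {b : ENNReal}
    (hb : ∀ x, P {ω | (x, fun i => W (s x i) (Y ω)) ∈ G} ≤ b) :
    P {ω | (fun i => X i ω, fun i => W (s (fun i => X i ω) i) (Y ω)) ∈ G} ≤ b := by
  have h1 : Measurable fun q : (ℕ → Eucl d) × F => (q.1, fun i => W (s q.1 i) q.2) :=
    measurable_fst.prodMk (measurable_pi_iff.2 fun i =>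
      hW.comp (((hs i).comp measurable_fst).prodMk measurable_snd))
  exact measure_le_of_forall_section (measurable_pi_iff.2 hX) hY hXY (h1 hG) hb

/-- Conditioning on the sites: an event that depends on the displacements `X` and on the values of
the field `Z` at the sites `s X` has probability at most `b`, if this holds for all deterministic
displacements. -/
theorem IsFieldIndepOf.measure_le {Ω : Type*} [mΩ : MeasurableSpace Ω] {P : Measure Ω}
    [IsProbabilityMeasure P] {d : ℕ} {X : ℕ → Ω → Eucl d} (hX : ∀ i, Measurable (X i))
    {Z : Eucl d → Ω → ℝ} {c₀ : Eucl d → ℝ} (hZ : IsFieldIndepOf P Z c₀ X)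
    {s : (ℕ → Eucl d) → ℕ → Eucl d} (hs : ∀ i, Measurable fun x => s x i)
    {G : Set ((ℕ → Eucl d) × (ℕ → ℝ))} (hG : MeasurableSet G) {b : ENNReal}
    (hb : ∀ x, P {ω | (x, fun i => Z (s x i) ω) ∈ G} ≤ b) :
    P {ω | (fun i => X i ω, fun i => Z (s (fun i => X i ω) i) ω) ∈ G} ≤ b := by
  obtain ⟨𝓖, h𝓖, hmeas, hind⟩ := hZ.measurable_indep
  have hXY : @IndepFun Ω (ℕ → Eucl d) Ω mΩ inferInstance 𝓖 (fun ω i => X i ω) id P := by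
    rw [IndepFun_iff_Indep, MeasurableSpace.comap_id]
    exact hind.symm
  exact @measure_field_le_of_indepFun Ω Ω mΩ 𝓖 P _ d X hX id (measurable_id'' h𝓖) hXY Z hmeas s hs
    G hG b hb

theorem measurable_gaussLogLik {α : Type*} [MeasurableSpace α] {n : ℕ}
    {A : α → Matrix (Fin n) (Fin n) ℝ} (hA : ∀ i j, Measurable fun a => A a i j)
    {z : α → Fin n → ℝ} (hz : ∀ i, Measurable fun a => z a i) :
    Measurable (fun a => z a ⬝ᵥ ((A a)⁻¹ *ᵥ z a)) ∧
      Measurable fun a => gaussLogLik (A a) (z a) := by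
  have hA' : Measurable fun a => fun i j => A a i j :=
    measurable_pi_iff.2 fun i => measurable_pi_iff.2 fun j => hA i j
  have hdet : Measurable fun a => (A a).det := by
    have h : Continuous fun M : Fin n → Fin n → ℝ => Matrix.det (Matrix.of M) :=
      Continuous.matrix_det continuous_id
    exact h.measurable.comp hA'
  have hadj : ∀ i j, Measurable fun a => (A a).adjugate i j := fun i j => by
    have h : Continuous fun M : Fin n → Fin n → ℝ => Matrix.adjugate (Matrix.of M) i j :=
      (Continuous.matrix_adjugate continuous_id).matrix_elem i j
    exact h.measurable.comp hA'
  have hinv : ∀ i j, Measurable fun a => (A a)⁻¹ i j := fun i j => by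
    simp only [Matrix.inv_def, Matrix.smul_apply, Ring.inverse_eq_inv', smul_eq_mul]
    exact hdet.inv.mul (hadj i j)
  have hq : Measurable fun a => z a ⬝ᵥ ((A a)⁻¹ *ᵥ z a) := by
    simp only [dotProduct, Matrix.mulVec]
    exact Finset.measurable_sum _ fun i _ => (hz i).mul
      (Finset.measurable_sum _ fun j _ => (hinv i j).mul (hz j))
  exact ⟨hq, ((Real.measurable_log.comp hdet).const_mul _).add (hq.const_mul _)⟩

/-! ### Properties of the covariance functions -/

theorem HasPositiveSpectralDensity.continuous {d p : ℕ} {Θ : Set (Eucl p)}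
    {c : Eucl p → Eucl d → ℝ} (hc : HasPositiveSpectralDensity Θ c) {θ : Eucl p} (hθ : θ ∈ Θ) :
    Continuous (c θ) := by
  obtain ⟨chat, -, -, h⟩ := hc
  obtain ⟨hint, hF⟩ := h θ hθ
  have he : c θ = fun s => ∫ f, chat θ f * Real.cos (inner ℝ f s) :=
    funext fun s => eq_integral_cos hint hF s
  rw [he]
  refine continuous_of_dominated (bound := fun f => ‖chat θ f‖) (fun s => ?_) (fun s => ?_)
    hint.norm (ae_of_all _ fun f => by fun_prop)
  · exact hint.aestronglyMeasurable.mul (by fun_prop)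
  · refine ae_of_all _ fun f => ?_
    rw [norm_mul]
    exact mul_le_of_le_one_right (norm_nonneg _) (Real.abs_cos_le_one _)

theorem HasPositiveSpectralDensity.even {d p : ℕ} {Θ : Set (Eucl p)}
    {c : Eucl p → Eucl d → ℝ} (hc : HasPositiveSpectralDensity Θ c) {θ : Eucl p} (hθ : θ ∈ Θ)
    (s : Eucl d) : c θ (-s) = c θ s := by
  obtain ⟨chat, -, -, h⟩ := hc
  obtain ⟨hint, hF⟩ := h θ hθ
  rw [eq_integral_cos hint hF, eq_integral_cos hint hF]
  simp

/-- The covariance functions depend on the parameter in a Lipschitz way, uniformly in space. -/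
theorem CovarianceRegularity.exists_lipschitz {d p : ℕ} {Θ : Set (Eucl p)} (hΘ : Convex ℝ Θ)
    {c : Eucl p → Eucl d → ℝ} {dc : Eucl p → Eucl d → Eucl p} (hc : CovarianceRegularity Θ c dc) :
    ∃ K : ℝ, 0 < K ∧ ∀ θ ∈ Θ, ∀ θ' ∈ Θ, ∀ s, |c θ' s - c θ s| ≤ K * ‖θ' - θ‖ := by
  obtain ⟨_, L, hL⟩ := hc.partials_bounded
  refine ⟨√(∑ _i : Fin p, L ^ 2) + 1, by positivity, fun θ hθ θ' hθ' s => ?_⟩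
  refine hΘ.norm_image_sub_le_of_norm_hasFDerivWithin_le (f := fun η => c η s)
    (fun η hη => ((hc.partials s).1 η hη).hasFDerivWithinAt) (fun η hη => ?_) hθ hθ'
  rw [LinearIsometryEquiv.norm_map, EuclideanSpace.norm_eq]
  have h : √(∑ i, ‖dc η s i‖ ^ 2) ≤ √(∑ _i : Fin p, L ^ 2) := by
    refine Real.sqrt_le_sqrt (Finset.sum_le_sum fun i _ => ?_)
    have := (hL (η, i) ⟨hη, Set.mem_univ i⟩).2 s
    rw [Real.norm_eq_abs]
    simp only at this
    gcongr
  linarith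

/-- Identifiability in terms of single points: a parameter different from `θ₀` changes the
covariance function at the origin or at a possible difference of two sites. -/
theorem AsymptoticallyIdentifiable.exists_ne {d p : ℕ} {τ : ℝ} {Θ : Set (Eucl p)}
    {c : Eucl p → Eucl d → ℝ} {θ₀ : Eucl p} (h : AsymptoticallyIdentifiable τ Θ c θ₀)
    {θ : Eucl p} (hθ : θ ∈ Θ) (hne : θ ≠ θ₀) (hcont : Continuous (c θ))
    (hcont₀ : Continuous (c θ₀)) : c θ 0 ≠ c θ₀ 0 ∨
      ∃ z : Fin d → ℤ, z ≠ 0 ∧ ∃ u₁ ∈ cube d, ∃ u₂ ∈ cube d,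
        c θ (intPoint z + τ • (u₁ - u₂)) ≠ c θ₀ (intPoint z + τ • (u₁ - u₂)) := by
  by_contra! hcon
  obtain ⟨h0, hD⟩ := hcon
  have hcube0 : (0 : Eucl d) ∈ cube d := fun k => by simp
  rcases eq_or_ne τ 0 with hτ | hτ
  · refine h.1 hτ ⟨θ, hθ, hne, fun z => ?_⟩
    rcases eq_or_ne z 0 with rfl | hz
    · have : intPoint (0 : Fin d → ℤ) = 0 := by ext k; simp [intPoint]
      rw [this, h0]
    · simpa using hD z hz 0 hcube0 0 hcube0
  · refine h.2 hτ ⟨θ, hθ, hne, ?_, h0⟩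
    have hzero : ∀ s ∈ differenceSet d τ, c θ s - c θ₀ s = 0 := by
      rintro s ⟨z, hz, u₁, hu₁, u₂, hu₂, rfl⟩
      exact sub_eq_zero.2 (hD z hz u₁ hu₁ u₂ hu₂)
    rw [ae_restrict_iff (measurableSet_eq_fun (by fun_prop) (by fun_prop))]
    exact ae_of_all _ hzero

theorem measurable_gridSite {d : ℕ} (τ : ℝ) (v : ℕ → Fin d → ℕ) (i : ℕ) :
    Measurable fun x : ℕ → Eucl d => gridSite τ v x i :=
  ((measurable_pi_apply i).const_smul τ).const_add _

/-! ### Likelihoods on the perturbed grid -/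

/-- The covariance matrices of the perturbed grid are bounded from below and from above, uniformly
in the parameter, the displacements and the number of sites. -/
theorem CovarianceRegularity.exists_bounds {d p : ℕ} (hd : 1 ≤ d) {Θ : Set (Eucl p)}
    (hΘ : IsCompact Θ) {τ : ℝ} (hτ : 0 ≤ τ) (hτ' : τ < 1 / 2) {v : ℕ → Fin d → ℕ}
    (hv : IsGridEnumeration v) {c : Eucl p → Eucl d → ℝ} {dc : Eucl p → Eucl d → Eucl p}
    (hc : CovarianceRegularity Θ c dc) : ∃ lam Lam : ℝ, 0 < lam ∧ 0 < Lam ∧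
      ∀ θ ∈ Θ, ∀ x : ℕ → Eucl d, (∀ i, x i ∈ cube d) → ∀ (n : ℕ) (y : Fin n → ℝ),
        lam * (y ⬝ᵥ y) ≤ y ⬝ᵥ (kernelMatrix (c θ) n (gridSite τ v x) *ᵥ y) ∧
        y ⬝ᵥ (kernelMatrix (c θ) n (gridSite τ v x) *ᵥ y) ≤ Lam * (y ⬝ᵥ y) := by
  have hρ : 0 < 1 - 2 * τ := by linarith
  obtain ⟨lam, hlam, hlow⟩ := exists_lower_bound hΘ hc.spectral hρ
  obtain ⟨C, L, hCL⟩ := hc.bounded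
  obtain ⟨N, hN, hop⟩ := exists_opNorm_bound d hρ C
  refine ⟨lam, N * (|L| + 1), hlam, by positivity, fun θ hθ x hx n y => ?_⟩
  have hs := isSpread_gridSite hd hτ hv hx
  refine ⟨hlow θ hθ hs y, (le_abs_self _).trans (hop hs ?_ ?_ (by positivity) y)⟩
  · intro i j
    exact ((hCL θ hθ).2 _).trans (by linarith [le_abs_self L])
  · intro i j hij
    refine image_eq_zero_of_notMem_tsupport (f := c θ) fun hmem => ?_
    have := (hCL θ hθ).1 hmem
    rw [mem_closedBall_zero_iff] at this
    linarith

/-- Replacing the covariance function of `θ` by a uniformly close approximation changes the matrices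
of the perturbed grid little in operator norm. -/
theorem exists_approximation_bound {d p : ℕ} (hd : 1 ≤ d) {Θ : Set (Eucl p)}
    {τ : ℝ} (hτ : 0 ≤ τ) (hτ' : τ < 1 / 2) {v : ℕ → Fin d → ℕ} (hv : IsGridEnumeration v)
    {c : Eucl p → Eucl d → ℝ} (hc : UniformlyBoundedCompactSupport Θ c)
    {ctil : ℕ → Eucl p → Eucl d → ℝ}
    (hctil : UniformlyBoundedCompactSupport ((Set.univ : Set ℕ) ×ˢ Θ) fun a => ctil a.1 a.2) :
    ∃ N : ℝ, 0 < N ∧ ∀ θ ∈ Θ, ∀ θ' ∈ Θ, ∀ (m : ℕ) (e : ℝ),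
      (∀ s, |ctil m θ' s - c θ s| ≤ e) → ∀ x : ℕ → Eucl d, (∀ i, x i ∈ cube d) →
      ∀ (n : ℕ) (y : Fin n → ℝ), |y ⬝ᵥ ((kernelMatrix (ctil m θ') n (gridSite τ v x) -
        kernelMatrix (c θ) n (gridSite τ v x)) *ᵥ y)| ≤ N * e * (y ⬝ᵥ y) := by
  obtain ⟨C, _, hC⟩ := hc
  obtain ⟨C', _, hC'⟩ := hctil
  obtain ⟨N, hN, hop⟩ := exists_opNorm_bound d (show 0 < 1 - 2 * τ by linarith) (max C C')
  refine ⟨N, hN, fun θ hθ θ' hθ' m e he x hx n y => ?_⟩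
  refine hop (isSpread_gridSite hd hτ hv hx) (fun i j => he _) (fun i j hij => ?_)
    ((abs_nonneg _).trans (he 0)) y
  have h1 : c θ (gridSite τ v x i - gridSite τ v x j) = 0 :=
    image_eq_zero_of_notMem_tsupport fun hmem => by
      have := (hC θ hθ).1 hmem
      rw [mem_closedBall_zero_iff] at this
      linarith [le_max_left C C']
  have h2 : ctil m θ' (gridSite τ v x i - gridSite τ v x j) = 0 :=
    image_eq_zero_of_notMem_tsupport fun hmem => by
      have := (hC' (m, θ') ⟨Set.mem_univ _, hθ'⟩).1 hmem
      rw [mem_closedBall_zero_iff] at this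
      linarith [le_max_right C C']
  change ctil m θ' (gridSite τ v x i - gridSite τ v x j) -
    c θ (gridSite τ v x i - gridSite τ v x j) = 0
  rw [h1, h2, sub_zero]

/-- Where the quadratic form of the observations is not too large, the truncated likelihood of an
approximation is close to the likelihood of the approximated covariance function. -/
theorem exists_truncatedLogLik_approx {d p : ℕ} (hd : 1 ≤ d) {Θ : Set (Eucl p)}
    (hΘ : IsCompact Θ) {θ₀ : Eucl p} (hθ₀ : θ₀ ∈ Θ) {τ : ℝ} (hτ : 0 ≤ τ) (hτ' : τ < 1 / 2)
    {v : ℕ → Fin d → ℕ} (hv : IsGridEnumeration v) {c : Eucl p → Eucl d → ℝ}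
    {dc : Eucl p → Eucl d → Eucl p} (hc : CovarianceRegularity Θ c dc)
    {ctil : ℕ → Eucl p → Eucl d → ℝ} {dctil : ℕ → Eucl p → Eucl d → Eucl p}
    (hctil : ApproximationRegularity Θ c dc ctil dctil) :
    ∃ K e₀ : ℝ, 0 < K ∧ 0 < e₀ ∧ ∀ θ ∈ Θ, ∀ θ' ∈ Θ, ∀ (m : ℕ) (e : ℝ), e ≤ e₀ →
      (∀ s, |ctil m θ' s - c θ s| ≤ e) → ∀ x : ℕ → Eucl d, (∀ i, x i ∈ cube d) →
      ∀ n : ℕ, 0 < n → ∀ z : ℕ → ℝ,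
      1 / (n : ℝ) * ((fun i : Fin n => z i) ⬝ᵥ
        ((kernelMatrix (c θ₀) n (gridSite τ v x))⁻¹ *ᵥ fun i : Fin n => z i)) ≤ 2 →
      |truncatedLogLik (ctil m θ') n (gridSite τ v x) z -
        gaussLogLik (kernelMatrix (c θ) n (gridSite τ v x)) (fun i => z i)| ≤ K * e := by
  obtain ⟨lam, Lam, hlam, hLam, hbd⟩ := hc.exists_bounds hd hΘ hτ hτ' hv
  obtain ⟨N, hN, happ⟩ := exists_approximation_bound hd hτ hτ' hv hc.bounded hctil.bounded
  refine ⟨N / (lam / 2) * (1 + Lam / lam * 2), lam / 2 / N, by positivity, by positivity, ?_⟩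
  intro θ hθ θ' hθ' m e he hclose x hx n hn z hz
  set A := kernelMatrix (c θ) n (gridSite τ v x)
  set A₀ := kernelMatrix (c θ₀) n (gridSite τ v x)
  set B := kernelMatrix (ctil m θ') n (gridSite τ v x) with hB
  have he0 : 0 ≤ e := (abs_nonneg _).trans (hclose 0)
  have hn' : (0 : ℝ) < n := by exact_mod_cast hn
  have hAB := happ θ hθ θ' hθ' m e hclose x hx n
  have hy0 : ∀ y : Fin n → ℝ, 0 ≤ y ⬝ᵥ y := fun y => by
    simpa [dotProduct] using Finset.sum_nonneg fun i _ => mul_self_nonneg (y i)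
  have hAlow : ∀ y, lam * (y ⬝ᵥ y) ≤ y ⬝ᵥ (A *ᵥ y) := fun y => (hbd θ hθ x hx n y).1
  have hA0low : ∀ y, lam * (y ⬝ᵥ y) ≤ y ⬝ᵥ (A₀ *ᵥ y) := fun y => (hbd θ₀ hθ₀ x hx n y).1
  have hNe : N * e ≤ lam / 2 := by
    rw [le_div_iff₀ hN] at he
    linarith
  have hBlow : ∀ y, lam / 2 * (y ⬝ᵥ y) ≤ y ⬝ᵥ (B *ᵥ y) := fun y => by
    have h1 := (abs_le.1 (hAB y)).1
    rw [Matrix.sub_mulVec, dotProduct_sub] at h1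
    nlinarith [hAlow y, mul_le_mul_of_nonneg_right hNe (hy0 y)]
  have hAh : A.IsHermitian := kernelMatrix_isHermitian (hc.spectral.even hθ) n _
  have hA0h : A₀.IsHermitian := kernelMatrix_isHermitian (hc.spectral.even hθ₀) n _
  have hBh : B.IsHermitian := kernelMatrix_isHermitian (hctil.even m θ' hθ') n _
  have hBp := posDef_of_le hBh (half_pos hlam) hBlow
  rw [truncatedLogLik_eq_gaussLogLik hBp, ← hB]
  have hA0A : ∀ y, y ⬝ᵥ (A₀ *ᵥ y) ≤ Lam / lam * (y ⬝ᵥ (A *ᵥ y)) := fun y => by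
    calc y ⬝ᵥ (A₀ *ᵥ y) ≤ Lam * (y ⬝ᵥ y) := (hbd θ₀ hθ₀ x hx n y).2
      _ = Lam / lam * (lam * (y ⬝ᵥ y)) := by field_simp
      _ ≤ _ := mul_le_mul_of_nonneg_left (hAlow y) (by positivity)
  have hquad := dotProduct_inv_le_of_le (posDef_of_le hA0h hlam hA0low) (posDef_of_le hAh hlam hAlow)
    hA0A (fun i : Fin n => z i)
  refine (abs_gaussLogLik_sub_le hn hAh hBh (half_pos hlam)
    (fun y => le_trans ?_ (hAlow y)) hBlow hAB _).trans ?_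
  · nlinarith [hy0 y]
  · calc _ ≤ N * e / (lam / 2) * (1 + Lam / lam * 2) := by
          have h2 : 1 / (n : ℝ) * ((fun i : Fin n => z i) ⬝ᵥ (A⁻¹ *ᵥ fun i : Fin n => z i)) ≤
              Lam / lam * 2 := by
            calc _ ≤ 1 / (n : ℝ) * (Lam / lam *
                  ((fun i : Fin n => z i) ⬝ᵥ (A₀⁻¹ *ᵥ fun i : Fin n => z i))) := by gcongr
              _ = Lam / lam * (1 / (n : ℝ) *
                  ((fun i : Fin n => z i) ⬝ᵥ (A₀⁻¹ *ᵥ fun i : Fin n => z i))) := by ring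
              _ ≤ _ := by gcongr
          gcongr
      _ = _ := by ring

theorem measurableSet_forall_mem_cube (d : ℕ) :
    MeasurableSet {x : ℕ → Eucl d | ∀ i, x i ∈ cube d} := by
  have h : {x : ℕ → Eucl d | ∀ i, x i ∈ cube d} =
      ⋂ i, ⋂ k, (fun x : ℕ → Eucl d => x i k) ⁻¹' Set.Icc (-1) 1 := by
    ext x; simp [cube]
  rw [h]
  exact MeasurableSet.iInter fun i => MeasurableSet.iInter fun k =>
    measurableSet_Icc.preimage (by fun_prop)

theorem measurable_kernelMatrix_gridSite {d : ℕ} {g : Eucl d → ℝ} (hg : Continuous g) (τ : ℝ)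
    (v : ℕ → Fin d → ℕ) (n : ℕ) (i j : Fin n) :
    Measurable fun q : (ℕ → Eucl d) × (ℕ → ℝ) => kernelMatrix g n (gridSite τ v q.1) i j :=
  hg.measurable.comp (((measurable_gridSite τ v i).sub (measurable_gridSite τ v j)).comp
    measurable_fst)

/-! ### Consistency -/

section Probability

variable {Ω : Type*} [MeasurableSpace Ω] {P : Measure Ω} [IsProbabilityMeasure P]
  {d p : ℕ} {Θ : Set (Eucl p)} {θ₀ : Eucl p} {τ : ℝ} {v : ℕ → Fin d → ℕ} {X : ℕ → Ω → Eucl d}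
  {c : Eucl p → Eucl d → ℝ} {dc : Eucl p → Eucl d → Eucl p} {Z : Eucl d → Ω → ℝ}

/-- The normalized quadratic form of the observations is at most `2` with probability tending
to one. -/
theorem tendsto_measure_quadForm_gt (hd : 1 ≤ d) (hΘ : IsCompact Θ) (hθ₀ : θ₀ ∈ Θ) (hτ : 0 ≤ τ)
    (hτ' : τ < 1 / 2) (hv : IsGridEnumeration v) (hX : IsPerturbation P X)
    (hc : CovarianceRegularity Θ c dc) (hZ : IsFieldIndepOf P Z (c θ₀) X) :
    Tendsto (fun n : ℕ => P {ω | 2 < 1 / (n : ℝ) * ((fun i : Fin n => Z (site τ v X i ω) ω) ⬝ᵥ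
      ((kernelMatrix (c θ₀) n fun i => site τ v X i ω)⁻¹ *ᵥ
        fun i : Fin n => Z (site τ v X i ω) ω))}) atTop (𝓝 0) := by
  obtain ⟨lam, Lam, hlam, hLam, hbd⟩ := hc.exists_bounds hd hΘ hτ hτ' hv
  have hlim : Tendsto (fun n : ℕ => ENNReal.ofReal (chiSqVariance / n)) atTop (𝓝 0) := by
    rw [← ENNReal.ofReal_zero]
    exact ENNReal.tendsto_ofReal (tendsto_const_div_atTop_nhds_zero_nat _)
  refine tendsto_of_tendsto_of_tendsto_of_le_of_le' tendsto_const_nhds hlim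
    (Eventually.of_forall fun _ => zero_le) ?_
  filter_upwards [eventually_gt_atTop 0] with n hn
  set G : Set ((ℕ → Eucl d) × (ℕ → ℝ)) := {q | (∀ i, q.1 i ∈ cube d) ∧
    2 < 1 / (n : ℝ) * ((fun i : Fin n => q.2 i) ⬝ᵥ
      ((kernelMatrix (c θ₀) n (gridSite τ v q.1))⁻¹ *ᵥ fun i : Fin n => q.2 i))}
  have hG : MeasurableSet G := by
    refine (measurable_fst (measurableSet_forall_mem_cube d)).inter (measurableSet_lt
      measurable_const ((measurable_gaussLogLik (fun i j => measurable_kernelMatrix_gridSite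
        (hc.spectral.continuous hθ₀) τ v n i j) fun i => ?_).1.const_mul _))
    exact (measurable_pi_apply _).comp measurable_snd
  refine (measure_mono fun ω hω => ?_).trans
    (hZ.measure_le hX.measurable (measurable_gridSite τ v) hG (b := ENNReal.ofReal _) fun x => ?_)
  · exact ⟨fun i => hX.mem_cube i ω, hω⟩
  · by_cases hx : ∀ i, x i ∈ cube d
    · refine (measure_mono fun ω hω => ?_).trans (measure_quadForm_gt_le
        (ζ := fun (i : Fin n) ω => Z (gridSite τ v x i) ω)
        (A := kernelMatrix (c θ₀) n (gridSite τ v x)) hn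
        (hZ.gaussian.comp_right fun i : Fin n => gridSite τ v x i) (fun i => hZ.mean_zero _)
        (fun i j => hZ.covariance_eq _ _) ?_)
      · exact hω.2
      · exact posDef_of_le (kernelMatrix_isHermitian (hc.spectral.even hθ₀) n _) hlam
          fun y => (hbd θ₀ hθ₀ x hx n y).1
    · refine le_trans (le_of_eq ?_) zero_le
      convert measure_empty (μ := P)
      exact Set.eq_empty_of_forall_notMem fun ω hω => hx hω.1

/-- For every parameter `θ ≠ θ₀`, the likelihood of `θ` exceeds the one of `θ₀` by a positive
constant, with probability tending to one. -/
theorem exists_tendsto_measure_gaussLogLik_sub_lt (hd : 1 ≤ d) (hΘ : IsCompact Θ) (hθ₀ : θ₀ ∈ Θ)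
    (hτ : 0 ≤ τ) (hτ' : τ < 1 / 2) (hv : IsGridEnumeration v) (hX : IsPerturbation P X)
    (hc : CovarianceRegularity Θ c dc) (hident : AsymptoticallyIdentifiable τ Θ c θ₀)
    (hZ : IsFieldIndepOf P Z (c θ₀) X) {θ : Eucl p} (hθ : θ ∈ Θ) (hne : θ ≠ θ₀) :
    ∃ η > 0, Tendsto (fun n : ℕ => P {ω |
      gaussLogLik (kernelMatrix (c θ) n fun i => site τ v X i ω)
          (fun i : Fin n => Z (site τ v X i ω) ω) -
        gaussLogLik (kernelMatrix (c θ₀) n fun i => site τ v X i ω)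
          (fun i : Fin n => Z (site τ v X i ω) ω) < η}) atTop (𝓝 0) := by
  obtain ⟨lam, Lam, hlam, hLam, hbd⟩ := hc.exists_bounds hd hΘ hτ hτ' hv
  have hcθ := hc.spectral.continuous hθ
  have hc₀ := hc.spectral.continuous hθ₀
  obtain ⟨δ, hδ, hsites⟩ := exists_sum_sites_lower_bound hd τ hv hX
    (g := fun s => (c θ s - c θ₀ s) ^ 2) (by fun_prop) (fun s => sq_nonneg _) (by
      rcases hident.exists_ne hθ hne hcθ hc₀ with h | ⟨z, hz, u₁, hu₁, u₂, hu₂, h⟩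
      · exact Or.inl (sq_pos_of_ne_zero (sub_ne_zero.2 h))
      · exact Or.inr ⟨z, hz, u₁, hu₁, u₂, hu₂, sq_pos_of_ne_zero (sub_ne_zero.2 h)⟩)
  obtain ⟨κ, hκ, K, hK, hmain⟩ := measure_gaussLogLik_sub_lt_le hlam hLam
  refine ⟨κ * δ, by positivity, ?_⟩
  have hlim : Tendsto (fun n : ℕ => ENNReal.ofReal (K / (n * δ))) atTop (𝓝 0) := by
    have h : ∀ n : ℕ, K / (n * δ) = K / δ / n := fun n => by rw [div_div, mul_comm δ]
    simp only [h]
    rw [← ENNReal.ofReal_zero]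
    exact ENNReal.tendsto_ofReal (tendsto_const_div_atTop_nhds_zero_nat _)
  have hlim2 := hsites.add hlim
  rw [add_zero] at hlim2
  refine tendsto_of_tendsto_of_tendsto_of_le_of_le' tendsto_const_nhds hlim2
    (Eventually.of_forall fun _ => zero_le) ?_
  filter_upwards [eventually_gt_atTop 0] with n hn
  set G : Set ((ℕ → Eucl d) × (ℕ → ℝ)) := {q | ∀ i, q.1 i ∈ cube d} ∩
    ({q | n * δ ≤ ∑ i, ∑ j, (kernelMatrix (c θ) n (gridSite τ v q.1) i j -
      kernelMatrix (c θ₀) n (gridSite τ v q.1) i j) ^ 2} ∩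
    {q | gaussLogLik (kernelMatrix (c θ) n (gridSite τ v q.1)) (fun i : Fin n => q.2 i) -
      gaussLogLik (kernelMatrix (c θ₀) n (gridSite τ v q.1)) (fun i : Fin n => q.2 i) < κ * δ})
  have hm := fun i j => measurable_kernelMatrix_gridSite hcθ τ v n i j
  have hm₀ := fun i j => measurable_kernelMatrix_gridSite hc₀ τ v n i j
  have hz : ∀ i : Fin n, Measurable fun q : (ℕ → Eucl d) × (ℕ → ℝ) => q.2 i := fun i =>
    (measurable_pi_apply _).comp measurable_snd
  have hG : MeasurableSet G := by
    refine (measurable_fst (measurableSet_forall_mem_cube d)).inter ((measurableSet_le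
      measurable_const ?_).inter (measurableSet_lt ((measurable_gaussLogLik hm hz).2.sub
        (measurable_gaussLogLik hm₀ hz).2) measurable_const))
    exact Finset.measurable_sum _ fun i _ => Finset.measurable_sum _ fun j _ =>
      ((hm i j).sub (hm₀ i j)).pow_const 2
  have hGle := hZ.measure_le hX.measurable (measurable_gridSite τ v) hG
    (b := ENNReal.ofReal (K / (n * δ))) fun x => by
      by_cases hx : (∀ i, x i ∈ cube d) ∧
          n * δ ≤ ∑ i, ∑ j, (kernelMatrix (c θ) n (gridSite τ v x) i j -
            kernelMatrix (c θ₀) n (gridSite τ v x) i j) ^ 2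
      · refine (measure_mono fun ω hω => ?_).trans (hmain
          (ζ := fun (i : Fin n) ω => Z (gridSite τ v x i) ω)
          (A := kernelMatrix (c θ₀) n (gridSite τ v x))
          (B := kernelMatrix (c θ) n (gridSite τ v x)) hn
          (hZ.gaussian.comp_right fun i : Fin n => gridSite τ v x i) (fun i => hZ.mean_zero _)
          (fun i j => hZ.covariance_eq _ _)
          (kernelMatrix_isHermitian (hc.spectral.even hθ₀) n _)
          (kernelMatrix_isHermitian (hc.spectral.even hθ) n _)
          (fun y => (hbd θ₀ hθ₀ x hx.1 n y).1) (fun y => (hbd θ₀ hθ₀ x hx.1 n y).2)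
          (fun y => (hbd θ hθ x hx.1 n y).1) (fun y => (hbd θ hθ x hx.1 n y).2) δ hδ hx.2)
        exact hω.2.2
      · refine le_trans (le_of_eq ?_) zero_le
        convert measure_empty (μ := P)
        exact Set.eq_empty_of_forall_notMem fun ω hω => hx ⟨hω.1, hω.2.1⟩
  refine le_trans (measure_mono fun ω hω => ?_) ((measure_union_le _ _).trans
    (add_le_add le_rfl hGle))
  rcases lt_or_ge (∑ i : Fin n, ∑ j : Fin n, (c θ (site τ v X i ω - site τ v X j ω) -
      c θ₀ (site τ v X i ω - site τ v X j ω)) ^ 2) (n * δ) with h | h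
  · exact Or.inl h
  · exact Or.inr ⟨fun i => hX.mem_cube i ω, h, hω⟩

/-- Every parameter `θ ≠ θ₀` has a neighbourhood which contains the estimator with probability
tending to zero. -/
theorem exists_tendsto_measure_mem_ball (hd : 1 ≤ d) (hΘ : IsCompact Θ) (hΘ' : Convex ℝ Θ)
    (hθ₀ : θ₀ ∈ Θ) (hτ : 0 ≤ τ) (hτ' : τ < 1 / 2) (hv : IsGridEnumeration v)
    (hX : IsPerturbation P X) (hc : CovarianceRegularity Θ c dc)
    (hident : AsymptoticallyIdentifiable τ Θ c θ₀) (hZ : IsFieldIndepOf P Z (c θ₀) X)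
    {ctil : ℕ → Eucl p → Eucl d → ℝ} {dctil : ℕ → Eucl p → Eucl d → Eucl p}
    (hctil : ApproximationRegularity Θ c dc ctil dctil) {r : ℕ → ℕ} (hr : Tendsto r atTop atTop)
    {θhat : ℕ → Ω → Eucl p} (hθhat : IsTruncatedMLE P Θ ctil r (site τ v X) Z θhat)
    {θ : Eucl p} (hθ : θ ∈ Θ) (hne : θ ≠ θ₀) :
    ∃ ε > 0, Tendsto (fun n => P {ω | θhat n ω ∈ Metric.ball θ ε}) atTop (𝓝 0) := by
  obtain ⟨K, e₀, hK, he₀, happ⟩ := exists_truncatedLogLik_approx hd hΘ hθ₀ hτ hτ' hv hc hctil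
  obtain ⟨Lip, hLip, hlip⟩ := hc.exists_lipschitz hΘ'
  obtain ⟨η, hη, hlik⟩ := exists_tendsto_measure_gaussLogLik_sub_lt hd hΘ hθ₀ hτ hτ' hv hX hc hident
    hZ hθ hne
  have hquad := tendsto_measure_quadForm_gt hd hΘ hθ₀ hτ hτ' hv hX hc hZ
  -- an error `e` changes each of the two likelihoods by at most a quarter of the gap `η`
  set e := min e₀ (η / (4 * K))
  have he0 : 0 < e := lt_min he₀ (by positivity)
  have hKe : K * e ≤ η / 4 := by
    calc K * e ≤ K * (η / (4 * K)) := by gcongr; exact min_le_right _ _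
      _ = η / 4 := by field_simp
  refine ⟨e / (2 * Lip), by positivity, ?_⟩
  have hlim := hlik.add hquad
  rw [add_zero] at hlim
  refine tendsto_of_tendsto_of_tendsto_of_le_of_le' tendsto_const_nhds hlim
    (Eventually.of_forall fun _ => zero_le) ?_
  have hunif := hr.eventually
    (Metric.tendstoUniformlyOn_iff.1 hctil.tendsto (e / 2) (half_pos he0))
  filter_upwards [eventually_ge_atTop 1, hunif] with n hn hclose
  have hclose' : ∀ θ' ∈ Θ, ∀ s, |ctil (r n) θ' s - c θ' s| ≤ e / 2 := fun θ' hθ' s => by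
    have := hclose (θ', s) ⟨hθ', Set.mem_univ s⟩
    rw [Real.dist_eq, abs_sub_comm] at this
    exact this.le
  refine le_trans ?_ (measure_union_le _ _)
  refine measure_mono_ae ?_
  filter_upwards [hθhat n hn] with ω hω hball
  by_contra hcon
  have h1 := fun h => hcon (Or.inl h)
  have h2 := fun h => hcon (Or.inr h)
  obtain ⟨hmem, hmin⟩ := hω
  have hdist : ‖θhat n ω - θ‖ < e / (2 * Lip) := by
    rw [← dist_eq_norm]; exact hball
  have hcl : ∀ s, |ctil (r n) (θhat n ω) s - c θ s| ≤ e := fun s => by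
    have h3 := hclose' _ hmem s
    have h4 : |c (θhat n ω) s - c θ s| ≤ e / 2 := by
      refine (hlip θ hθ _ hmem s).trans ?_
      calc Lip * ‖θhat n ω - θ‖ ≤ Lip * (e / (2 * Lip)) := by gcongr
        _ = e / 2 := by field_simp
    have h5 := abs_sub_le (ctil (r n) (θhat n ω) s) (c (θhat n ω) s) (c θ s)
    linarith
  have hn0 : 0 < n := hn
  have hx : ∀ i, X i ω ∈ cube d := fun i => hX.mem_cube i ω
  have h6 := happ θ hθ _ hmem (r n) e (min_le_left _ _) hcl (fun i => X i ω) hx n hn0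
    (fun i => Z (site τ v X i ω) ω) (not_lt.1 h2)
  have h7 := happ θ₀ hθ₀ _ hθ₀ (r n) e (min_le_left _ _)
    (fun s => (hclose' θ₀ hθ₀ s).trans (by linarith)) (fun i => X i ω) hx n hn0
    (fun i => Z (site τ v X i ω) ω) (not_lt.1 h2)
  have h8 : truncatedLogLik (ctil (r n) (θhat n ω)) n (gridSite τ v fun i => X i ω)
      (fun i => Z (site τ v X i ω) ω) ≤ truncatedLogLik (ctil (r n) θ₀) n
        (gridSite τ v fun i => X i ω) (fun i => Z (site τ v X i ω) ω) := hmin θ₀ hθ₀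
  have h9 : η ≤ gaussLogLik (kernelMatrix (c θ) n (gridSite τ v fun i => X i ω))
        (fun i : Fin n => Z (site τ v X i ω) ω) -
      gaussLogLik (kernelMatrix (c θ₀) n (gridSite τ v fun i => X i ω))
        (fun i : Fin n => Z (site τ v X i ω) ω) := not_lt.1 h1
  have h10 := (abs_le.1 h6).1
  have h11 := (abs_le.1 h7).2
  linarith

end Probability

theorem theorem1 {Ω : Type*} [MeasurableSpace Ω] (P : Measure Ω) [IsProbabilityMeasure P]
    {d p : ℕ} (hd : 1 ≤ d)
    (Θ : Set (Eucl p)) (hΘ_compact : IsCompact Θ) (hΘ_convex : Convex ℝ Θ)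
    (θ₀ : Eucl p) (hθ₀ : θ₀ ∈ Θ)
    (τ : ℝ) (hτ_nonneg : 0 ≤ τ) (hτ_lt : τ < 1 / 2)
    (v : ℕ → Fin d → ℕ) (hv : IsGridEnumeration v)
    (X : ℕ → Ω → Eucl d) (hX : IsPerturbation P X)
    (c : Eucl p → Eucl d → ℝ) (dc : Eucl p → Eucl d → Eucl p)
    (hc : CovarianceRegularity Θ c dc)
    (hident : AsymptoticallyIdentifiable τ Θ c θ₀)
    (Z : Eucl d → Ω → ℝ) (hZ : IsFieldIndepOf P Z (c θ₀) X)
    (ctil : ℕ → Eucl p → Eucl d → ℝ) (dctil : ℕ → Eucl p → Eucl d → Eucl p)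
    (hctil : ApproximationRegularity Θ c dc ctil dctil)
    (r : ℕ → ℕ) (hr : Tendsto r atTop atTop)
    (θhat : ℕ → Ω → Eucl p)
    (hθhat : IsTruncatedMLE P Θ ctil r (site τ v X) Z θhat) :
    TendstoInMeasure P θhat atTop (fun _ => θ₀) := by
  rw [tendstoInMeasure_iff_dist]
  intro ε hε
  have hcpt : IsCompact (Θ \ Metric.ball θ₀ ε) := hΘ_compact.diff Metric.isOpen_ball
  have hball : ∀ θ ∈ Θ \ Metric.ball θ₀ ε, ∃ ε' > 0,
      Tendsto (fun n => P {ω | θhat n ω ∈ Metric.ball θ ε'}) atTop (𝓝 0) := fun θ hθ =>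
    exists_tendsto_measure_mem_ball hd hΘ_compact hΘ_convex hθ₀ hτ_nonneg hτ_lt hv hX hc hident hZ
      hctil hr hθhat hθ.1 fun h => hθ.2 (h ▸ Metric.mem_ball_self hε)
  choose! ε' hε' hlim using hball
  obtain ⟨t, ht, hcover⟩ := hcpt.elim_nhds_subcover (fun θ => Metric.ball θ (ε' θ))
    fun θ hθ => Metric.ball_mem_nhds θ (hε' θ hθ)
  have hsum : Tendsto (fun n => ∑ θ ∈ t, P {ω | θhat n ω ∈ Metric.ball θ (ε' θ)}) atTop (𝓝 0) := by
    have := tendsto_finsetSum t fun θ hθ => hlim θ (ht θ hθ)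
    simpa using this
  refine tendsto_of_tendsto_of_tendsto_of_le_of_le' tendsto_const_nhds hsum
    (Eventually.of_forall fun _ => zero_le) ?_
  filter_upwards [eventually_ge_atTop 1] with n hn
  refine le_trans (measure_mono_ae ?_) (measure_biUnion_finset_le t _)
  filter_upwards [hθhat n hn] with ω hω hdist
  have hmem : θhat n ω ∈ Θ \ Metric.ball θ₀ ε := ⟨hω.1, fun h => not_lt.2 hdist h⟩
  obtain ⟨θ, hθ, hθ'⟩ := Set.mem_iUnion₂.1 (hcover hmem)
  exact Set.mem_iUnion₂.2 ⟨θ, hθ, hθ'⟩
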